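/- **Theorem (forward regularity for discretized Itô diffusions).** Let $d,m,N\in\mathbb N$ with $N\ge 1$, let $b:\mathbb R^d\to\mathbb R^d$ be $L$-Lipschitz ($L\ge 0$), let $\sigma\in\mathbb R^{d\times m}$ satisfy $\sigma\sigma^{\mathsf T}\succeq\lambda I$ with $\lambda>0$, and let $h>0$ satisfy $Lh<1$. Let $\hat P_h$ be the Markov kernel $\hat P_h(x,\cdot)=\mathcal N(x+h\,b(x),\,h\,\sigma\sigma^{\mathsf T})$ on $\mathbb R^d$, put $r=1-Lh$ and $$c=\frac{1-r^2}{2\lambda h\,(1-r^{2N})},$$ where for $L=0$ (i.e. $r=1$) the quotient is read as its limiting value $c=\frac1{2\lambda hN}$. For probability measures $\nu,\nu'$ on $\mathbb R^d$ let $\mathscr C(\nu,\nu')$ be the set of their couplings and $W_2^2(\nu,\nu')=\inf_{\gamma\in\mathscr C(\nu,\nu')}\int\|v-v'\|^2\,\gamma(\mathrm dv,\mathrm dv')\in[0,\infty]$. For $q>1$ let $\mathsf R_q(\mu\,\|\,\nu)=\frac1{q-1}\log\int(\frac{\mathrm d\mu}{\mathrm d\nu})^q\,\mathrm d\nu$ if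 $\mu\ll\nu$ and $\infty$ otherwise, and let $\mathsf R_1=\mathsf{KL}$. (i) For all probability measures $\mu,\nu,\nu'$ on $\mathbb R^d$ (no moment assumptions; both sides may be infinite), $$\mathsf{KL}(\mu\hat P_h^N*\nu\,\|\,\mu\hat P_h^N*\nu')\le c\,W_2^2(\nu,\nu'),$$ and for every $q\ge 1$, $$\mathsf R_q(\mu\hat P_h^N*\nu\,\|\,\mu\hat P_h^N*\nu')\le\inf_{\gamma\in\mathscr C(\nu,\nu')}\frac1{q-1}\log\int\exp\bigl(q(q-1)\,c\,\|v-v'\|^2\bigr)\,\gamma(\mathrm dv,\mathrm dv'),$$ where for $q=1$ the expression under the infimum is read as its limiting value $c\int\|v-v'\|^2\,\gamma(\mathrm dv,\mathrm dv')$. (ii) (Tightness for Ornstein–Uhlenbeck.) For all $d,N,L,\lambda,h$ as above, the choice $b(x)=-Lx$, $\sigma=\sqrt\lambda\,I$ with $m=d$, i.e. $\hat P_h(x,\cdot)=\mathcal N(rx,\lambda hI)$, satisfies the hypotheses, and for it both bounds in (i) are equalities whenever $\mu=\delta_x$, $\nu=\delta_v$, $\nu'=\delta_{v'}$ with $x,v,v'\in\mathbb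 R^d$: for every $q\ge1$, $$\mathsf R_q(\delta_x\hat P_h^N*\delta_v\,\|\,\delta_x\hat P_h^N*\delta_{v'})=q\,c\,\|v-v'\|^2,$$ which equals the right-hand side of the Rényi bound, and for $q=1$ also the right-hand side $c\,W_2^2(\delta_v,\delta_{v'})$ of the KL bound. -/

import Mathlib

open MeasureTheory ProbabilityTheory InformationTheory
open scoped NNReal ENNReal Matrix

noncomputable section

/-- The couplings of `ν` and `ν'`: measures on the product with marginals `ν` and `ν'`.
If `ν` is a probability measure, so is every coupling. -/
def couplings {E : Type*} [MeasurableSpace E] (ν ν' : Measure E) : Set (Measure (E × E)) :=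
  {γ | γ.map Prod.fst = ν ∧ γ.map Prod.snd = ν'}

/-- The quadratic transport cost `∫ ‖v - v'‖² γ(dv, dv')`, possibly infinite. -/
def quadraticCost {E : Type*} [NormedAddCommGroup E] [MeasurableSpace E]
    (γ : Measure (E × E)) : ℝ≥0∞ :=
  ∫⁻ p, ENNReal.ofReal (‖p.1 - p.2‖ ^ 2) ∂γ

/-- The 2-Wasserstein distance, with values in `[0, ∞]`. -/
def wasserstein2 {E : Type*} [NormedAddCommGroup E] [MeasurableSpace E]
    (ν ν' : Measure E) : ℝ≥0∞ :=
  (⨅ γ ∈ couplings ν ν', quadraticCost γ) ^ (1 / 2 : ℝ)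

open scoped Classical in
/-- The Rényi divergence of order `q ≥ 1` between probability measures, with values in the
extended reals: `∞` if `μ` is not absolutely continuous with respect to `ν`, the
Kullback–Leibler divergence if `q = 1`, and `(q - 1)⁻¹ log ∫ (dμ/dν)^q dν` if `q > 1`. -/
def renyiDiv {E : Type*} [MeasurableSpace E] (q : ℝ) (μ ν : Measure E) : EReal :=
  if μ ≪ ν then
    if q = 1 then (klDiv μ ν : EReal)
    else ((1 / (q - 1) : ℝ) : EReal) * ENNReal.log (∫⁻ x, (μ.rnDeriv ν x) ^ q ∂ν)
  else ⊤

open scoped Classical in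
/-- `(q - 1)⁻¹ log ∫ exp (q (q - 1) c ‖v - v'‖²) γ(dv, dv')` for `q > 1`, and its limiting value
`c ∫ ‖v - v'‖² γ(dv, dv')` for `q = 1`. -/
def renyiCost {E : Type*} [NormedAddCommGroup E] [MeasurableSpace E]
    (q c : ℝ) (γ : Measure (E × E)) : EReal :=
  if q = 1 then ((ENNReal.ofReal c * quadraticCost γ : ℝ≥0∞) : EReal)
  else ((1 / (q - 1) : ℝ) : EReal) *
    ENNReal.log (∫⁻ p, ENNReal.ofReal (Real.exp (q * (q - 1) * c * ‖p.1 - p.2‖ ^ 2)) ∂γ)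

open scoped MatrixOrder in
/-- The translates of a fixed Gaussian depend measurably on the mean. -/
theorem measurable_multivariateGaussian_mean {d : ℕ} (S : Matrix (Fin d) (Fin d) ℝ)
    {f : EuclideanSpace ℝ (Fin d) → EuclideanSpace ℝ (Fin d)} (hf : Measurable f) :
    Measurable fun x => multivariateGaussian (f x) S := by
  refine Measure.measurable_of_measurable_coe _ fun s hs => ?_
  have hA : Measurable fun y => Matrix.toEuclideanCLM (𝕜 := ℝ) (CFC.sqrt S) y :=
    ContinuousLinearMap.measurable _
  have key : ∀ x, multivariateGaussian (f x) S s =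
      ∫⁻ y, s.indicator 1 (f x + Matrix.toEuclideanCLM (𝕜 := ℝ) (CFC.sqrt S) y)
        ∂(stdGaussian (EuclideanSpace ℝ (Fin d))) := by
    intro x
    rw [multivariateGaussian, ← lintegral_indicator_one hs,
      lintegral_map (measurable_one.indicator hs) (hA.const_add _)]
  simp_rw [key]
  refine Measurable.lintegral_prod_right' (f := fun p : EuclideanSpace ℝ (Fin d) ×
    EuclideanSpace ℝ (Fin d) => s.indicator (1 : EuclideanSpace ℝ (Fin d) → ℝ≥0∞)
      (f p.1 + Matrix.toEuclideanCLM (𝕜 := ℝ) (CFC.sqrt S) p.2)) ?_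
  exact (measurable_one.indicator hs).comp
    ((hf.comp measurable_fst).add (hA.comp measurable_snd))

/-- One step of the Euler discretization of `dX = b(X) dt + σ dB` with step size `h`: the Markov
kernel `x ↦ N(x + h b(x), h σ σᵀ)`. -/
def eulerKernel {d m : ℕ} (b : EuclideanSpace ℝ (Fin d) → EuclideanSpace ℝ (Fin d))
    (hb : Measurable b) (σ : Matrix (Fin d) (Fin m) ℝ) (h : ℝ) :
    Kernel (EuclideanSpace ℝ (Fin d)) (EuclideanSpace ℝ (Fin d)) where
  toFun x := multivariateGaussian (x + h • b x) (h • (σ * σᵀ))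
  measurable' := measurable_multivariateGaussian_mean _ (measurable_id.add (hb.const_smul h))

/-- The law `μ P^N` after `N` Euler steps started from `μ`, with `P` the one-step kernel. -/
def eulerLaw {d m : ℕ} (b : EuclideanSpace ℝ (Fin d) → EuclideanSpace ℝ (Fin d))
    (hb : Measurable b) (σ : Matrix (Fin d) (Fin m) ℝ) (h : ℝ) (N : ℕ)
    (μ : Measure (EuclideanSpace ℝ (Fin d))) : Measure (EuclideanSpace ℝ (Fin d)) :=
  μ.bind ⇑(eulerKernel b hb σ h ^ N)

/-- The constant `(1 - r²) / (2 λ h (1 - r^(2N)))`; at `r = 1`, where this reads `0 / 0`, it is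
given its limiting value `1 / (2 λ h N)`. -/
def regConst (lam h r : ℝ) (N : ℕ) : ℝ :=
  if r = 1 then 1 / (2 * lam * h * N) else (1 - r ^ 2) / (2 * lam * h * (1 - r ^ (2 * N)))

/-- The drift `x ↦ -L x` of the Ornstein–Uhlenbeck process. -/
def ouDrift (d : ℕ) (L : ℝ) (x : EuclideanSpace ℝ (Fin d)) : EuclideanSpace ℝ (Fin d) :=
  -(L • x)

theorem measurable_ouDrift (d : ℕ) (L : ℝ) : Measurable (ouDrift d L) :=
  (measurable_id.const_smul L).neg

/-- The diffusion matrix `√λ I` of the Ornstein–Uhlenbeck process `dX = -L X dt + √λ dB`. -/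
def ouDiffusion (d : ℕ) (lam : ℝ) : Matrix (Fin d) (Fin d) ℝ :=
  Real.sqrt lam • (1 : Matrix (Fin d) (Fin d) ℝ)

/-- The law `δ_x P^N`, where `P` is the Euler kernel of the Ornstein–Uhlenbeck process. -/
def ouLaw (d : ℕ) (L lam h : ℝ) (N : ℕ) (x : EuclideanSpace ℝ (Fin d)) :
    Measure (EuclideanSpace ℝ (Fin d)) :=
  eulerLaw (ouDrift d L) (measurable_ouDrift d L) (ouDiffusion d lam) h N (Measure.dirac x)

end

/-!
The proof never writes down the `N`-step transition densities. A Rényi bound `R_q(P ‖ Q) ≤ R` with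
`q > 1` is equivalent, by Hölder's inequality and its converse, to the family of inequalities
`∫ f dP ≤ exp ((q - 1) / q * R) (∫ f ^ p dQ) ^ (1 / p)` for all measurable `f ≥ 0`, where `p` is
conjugate to `q` (`absolutelyContinuous_and_lintegral_rnDeriv_rpow_le`). In this dual form the bound
behaves well under composition of kernels.

For one Gaussian step the dual bound is Hölder's inequality applied to the Cameron-Martin density
(`map_add_stdGaussian`, `lintegral_add_multivariateGaussian_le`). To compare the law of `X_N + v`
with that of `X_N + v'`, put `w = v - v'` and follow the shifted paths `X_k + s_k w` with
`s_0 = 0 ≤ s_1 ≤ ... ≤ s_N = 1`. In step `k` the drift carries the shift `s_k w` to one that differs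
from `s_(k+1) w` by at most `(s_(k+1) - r s_k) ‖w‖`, where `r = 1 - L h`, and this difference is
absorbed by the noise of covariance at least `λ h I`. The costs add up
(`lintegral_kernel_pow_add_le`) to `∑ (s_(k+1) - r s_k)² ‖w‖² / (2 λ h)`; the minimizing
shifts `interpShift` make this `c ‖w‖²` (`sum_sq_interpShift`, `regConst_eq`).

This shift-Harnack inequality is integrated over the initial law by Jensen's inequality and
over a coupling of `ν` and `ν'` by Hölder's inequality, which gives the Rényi bounds
(`renyiDiv_conv_le`). For `q = 1`, test functions `exp (g / p)` and the limit `q → 1` produce the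
Donsker-Varadhan inequality `∫ g dP ≤ c ‖w‖² + ∫ exp g dQ - 1`. Being linear in `P`, `Q` and the
cost, it can be integrated over the coupling, and truncated log-densities `g` together with Fatou's
lemma turn it into the bound on the Kullback-Leibler divergence (`klDiv_conv_le`).

For the Ornstein-Uhlenbeck kernel the law after `N` steps is an isotropic Gaussian measure of
variance `λ h ∑ r ^ (2 j)` (`ouLaw_eq`), the divergences between its translates are explicit
(`renyiDiv_map_affine_stdGaussian`), and Dirac masses have a single coupling (`couplings_dirac`).
-/

noncomputable section

/-! ### Translates of the standard Gaussian measure -/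

section Gaussian

open Complex in
/-- The joint Laplace and Fourier transform of the standard Gaussian measure. -/
theorem integral_cexp_inner_add_inner_mul_I_stdGaussian {d : ℕ}
    (a t : EuclideanSpace ℝ (Fin d)) :
    ∫ y, cexp ((inner ℝ y a : ℝ) + (inner ℝ y t : ℝ) * I)
        ∂(stdGaussian (EuclideanSpace ℝ (Fin d)))
      = cexp ((‖a‖ ^ 2 - ‖t‖ ^ 2 + 2 * (inner ℝ a t : ℝ) * I) / 2) := by
  rw [← map_pi_eq_stdGaussian, integral_map (Measurable.aemeasurable (by fun_prop))
    (Measurable.aestronglyMeasurable (by fun_prop))]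
  have h1 : ∀ x : Fin d → ℝ,
      cexp ((inner ℝ (WithLp.toLp 2 x) a : ℝ) + (inner ℝ (WithLp.toLp 2 x) t : ℝ) * I)
        = ∏ i, cexp ((a i + t i * I) * (x i : ℂ)) := by
    intro x
    rw [← Complex.exp_sum]
    congr 1
    simp only [PiLp.inner_apply, ofReal_sum, Finset.sum_mul, ← Finset.sum_add_distrib]
    refine Finset.sum_congr rfl fun i _ => ?_
    simp
    ring
  simp_rw [h1]
  rw [integral_fintype_prod_eq_prod (f := fun i (x : ℝ) => cexp ((a i + t i * I) * (x : ℂ)))]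
  have h2 : ∀ i, ∫ x : ℝ, cexp ((a i + t i * I) * (x : ℂ)) ∂(gaussianReal 0 1)
      = cexp ((a i + t i * I) ^ 2 / 2) := by
    intro i
    have := complexMGF_id_gaussianReal (μ := 0) (v := 1) (a i + t i * I)
    simpa [complexMGF] using this
  simp_rw [h2]
  rw [← Complex.exp_sum]
  congr 1
  rw [← Finset.sum_div]
  congr 1
  rw [← ofReal_pow, ← ofReal_pow, EuclideanSpace.real_norm_sq_eq, EuclideanSpace.real_norm_sq_eq]
  simp only [PiLp.inner_apply, ofReal_sum, Finset.sum_mul, Finset.mul_sum,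
    ← Finset.sum_add_distrib, ← Finset.sum_sub_distrib]
  refine Finset.sum_congr rfl fun i _ => ?_
  simp
  linear_combination (t i : ℂ) ^ 2 * I_sq

theorem integral_exp_inner_stdGaussian {d : ℕ} (a : EuclideanSpace ℝ (Fin d)) :
    ∫ y, Real.exp (inner ℝ y a) ∂(stdGaussian (EuclideanSpace ℝ (Fin d)))
      = Real.exp (‖a‖ ^ 2 / 2) := by
  have h := integral_cexp_inner_add_inner_mul_I_stdGaussian a 0
  simp only [inner_zero_right, Complex.ofReal_zero, zero_mul, add_zero, norm_zero] at h
  simp_rw [← Complex.ofReal_exp] at h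
  rw [integral_complex_ofReal] at h
  apply Complex.ofReal_injective
  rw [h]
  push_cast
  congr 1
  simp

theorem integrable_exp_inner_stdGaussian {d : ℕ} (a : EuclideanSpace ℝ (Fin d)) :
    Integrable (fun y => Real.exp (inner ℝ y a)) (stdGaussian (EuclideanSpace ℝ (Fin d))) := by
  refine Integrable.of_integral_ne_zero ?_
  rw [integral_exp_inner_stdGaussian]
  positivity

theorem lintegral_exp_inner_stdGaussian {d : ℕ} (a : EuclideanSpace ℝ (Fin d)) (c : ℝ) :
    ∫⁻ y, ENNReal.ofReal (Real.exp (inner ℝ y a - c)) ∂(stdGaussian (EuclideanSpace ℝ (Fin d)))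
      = ENNReal.ofReal (Real.exp (‖a‖ ^ 2 / 2 - c)) := by
  simp_rw [Real.exp_sub]
  rw [← ofReal_integral_eq_lintegral_ofReal
    ((integrable_exp_inner_stdGaussian a).div_const _) (ae_of_all _ fun _ => by positivity),
    integral_div, integral_exp_inner_stdGaussian]

/-- The density of the translate by `a` of the standard Gaussian measure with respect to the
standard Gaussian measure itself. -/
def gaussianTilt {d : ℕ} (a y : EuclideanSpace ℝ (Fin d)) : ℝ :=
  Real.exp (inner ℝ y a - ‖a‖ ^ 2 / 2)

theorem measurable_gaussianTilt {d : ℕ} (a : EuclideanSpace ℝ (Fin d)) :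
    Measurable (gaussianTilt a) := by
  unfold gaussianTilt
  fun_prop

/-- The Cameron-Martin formula in finite dimension. Both sides have the same characteristic
function. -/
theorem map_add_stdGaussian {d : ℕ} (a : EuclideanSpace ℝ (Fin d)) :
    (stdGaussian (EuclideanSpace ℝ (Fin d))).map (fun y => a + y)
      = (stdGaussian (EuclideanSpace ℝ (Fin d))).withDensity
          fun y => ENNReal.ofReal (gaussianTilt a y) := by
  have hfin : IsFiniteMeasure ((stdGaussian (EuclideanSpace ℝ (Fin d))).withDensity
      fun y => ENNReal.ofReal (gaussianTilt a y)) := by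
    refine isFiniteMeasure_withDensity ?_
    simp only [gaussianTilt]
    rw [lintegral_exp_inner_stdGaussian]
    simp
  have : IsProbabilityMeasure ((stdGaussian (EuclideanSpace ℝ (Fin d))).map (fun y => a + y)) :=
    Measure.isProbabilityMeasure_map (by fun_prop)
  apply Measure.ext_of_charFun
  ext t
  rw [charFun_apply, charFun_apply, integral_map (by fun_prop)
    (Measurable.aestronglyMeasurable (by fun_prop)),
    integral_withDensity_eq_integral_toReal_smul
      (measurable_gaussianTilt a).ennreal_ofReal (by simp)]
  have h1 : ∀ y : EuclideanSpace ℝ (Fin d),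
      Complex.exp ((inner ℝ (a + y) t : ℝ) * Complex.I)
        = Complex.exp ((inner ℝ a t : ℝ) * Complex.I)
          * Complex.exp ((inner ℝ y t : ℝ) * Complex.I) := by
    intro y
    rw [← Complex.exp_add, inner_add_left]
    push_cast
    ring_nf
  have h2 : ∀ y : EuclideanSpace ℝ (Fin d),
      (ENNReal.ofReal (gaussianTilt a y)).toReal • Complex.exp ((inner ℝ y t : ℝ) * Complex.I)
        = Complex.exp (-(‖a‖ ^ 2 / 2 : ℝ))
          * Complex.exp ((inner ℝ y a : ℝ) + (inner ℝ y t : ℝ) * Complex.I) := by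
    intro y
    rw [gaussianTilt, ENNReal.toReal_ofReal (Real.exp_pos _).le, Complex.real_smul,
      Complex.ofReal_exp, ← Complex.exp_add, ← Complex.exp_add]
    push_cast
    ring_nf
  simp_rw [h1, h2]
  rw [integral_const_mul, integral_const_mul, integral_cexp_inner_add_inner_mul_I_stdGaussian,
    ← charFun_apply, charFun_stdGaussian, ← Complex.exp_add, ← Complex.exp_add]
  push_cast
  ring_nf

theorem lintegral_gaussianTilt_rpow {d : ℕ} (a : EuclideanSpace ℝ (Fin d)) (q : ℝ) :
    ∫⁻ y, ENNReal.ofReal (gaussianTilt a y) ^ q ∂(stdGaussian (EuclideanSpace ℝ (Fin d)))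
      = ENNReal.ofReal (Real.exp (q * (q - 1) * ‖a‖ ^ 2 / 2)) := by
  have h : ∀ y, ENNReal.ofReal (gaussianTilt a y) ^ q
      = ENNReal.ofReal (Real.exp (inner ℝ y (q • a) - q * ‖a‖ ^ 2 / 2)) := by
    intro y
    rw [gaussianTilt, ENNReal.ofReal_rpow_of_pos (Real.exp_pos _), ← Real.exp_mul,
      inner_smul_right]
    ring_nf
  simp_rw [h]
  rw [lintegral_exp_inner_stdGaussian, norm_smul, mul_pow, Real.norm_eq_abs, sq_abs]
  ring_nf

/-- A dimension-free Harnack inequality for translates of the standard Gaussian measure: Hölder's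
inequality applied to the Cameron-Martin density. -/
theorem lintegral_add_stdGaussian_le {d : ℕ} (a : EuclideanSpace ℝ (Fin d)) {p q : ℝ}
    (hpq : p.HolderConjugate q) {u : EuclideanSpace ℝ (Fin d) → ℝ≥0∞} (hu : Measurable u) :
    ∫⁻ y, u (a + y) ∂(stdGaussian (EuclideanSpace ℝ (Fin d)))
      ≤ ENNReal.ofReal (Real.exp ((q - 1) * (‖a‖ ^ 2 / 2)))
        * (∫⁻ y, u y ^ p ∂(stdGaussian (EuclideanSpace ℝ (Fin d)))) ^ (1 / p) := by
  have hm := (measurable_gaussianTilt a).ennreal_ofReal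
  rw [← lintegral_map hu (by fun_prop), map_add_stdGaussian,
    lintegral_withDensity_eq_lintegral_mul _ hm hu, mul_comm]
  refine (ENNReal.lintegral_mul_le_Lp_mul_Lq _ hpq hu.aemeasurable hm.aemeasurable).trans ?_
  rw [lintegral_gaussianTilt_rpow, mul_comm, ENNReal.ofReal_rpow_of_pos (Real.exp_pos _),
    ← Real.exp_mul]
  have hq := hpq.symm.ne_zero
  rw [show q * (q - 1) * ‖a‖ ^ 2 / 2 * (1 / q) = (q - 1) * (‖a‖ ^ 2 / 2) by field_simp]

open scoped MatrixOrder in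
/-- The Harnack inequality for two Gaussian measures with the same covariance `S ⪰ k I`: the
difference of the means is `√S a` with `‖a‖² ≤ ‖m + z - m'‖² / k`. -/
theorem lintegral_add_multivariateGaussian_le {d : ℕ} {S : Matrix (Fin d) (Fin d) ℝ} {k : ℝ}
    (hk : 0 < k) (hS : (S - k • (1 : Matrix (Fin d) (Fin d) ℝ)).PosSemidef)
    (m m' z : EuclideanSpace ℝ (Fin d)) {p q : ℝ} (hpq : p.HolderConjugate q)
    {u : EuclideanSpace ℝ (Fin d) → ℝ≥0∞} (hu : Measurable u) :
    ∫⁻ y, u (y + z) ∂(multivariateGaussian m S)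
      ≤ ENNReal.ofReal (Real.exp ((q - 1) * (‖m + z - m'‖ ^ 2 / (2 * k))))
        * (∫⁻ y, u y ^ p ∂(multivariateGaussian m' S)) ^ (1 / p) := by
  have hS0 : S.PosSemidef := by
    have := hS.add ((Matrix.PosSemidef.one (n := Fin d) (R := ℝ)).smul hk.le)
    simpa using this
  set A := Matrix.toEuclideanCLM (𝕜 := ℝ) (CFC.sqrt S) with hA
  -- `A` is symmetric with `A² = S`, so `‖A y‖² = ⟨y, S y⟩ ≥ k ‖y‖²`
  have hAnorm : ∀ y, k * ‖y‖ ^ 2 ≤ ‖A y‖ ^ 2 := by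
    intro y
    have hsa : IsSelfAdjoint A := (CFC.sqrt_nonneg S).isSelfAdjoint.map _
    have h1 : ‖A y‖ ^ 2 = inner ℝ y (Matrix.toEuclideanCLM (𝕜 := ℝ) S y) := by
      rw [← real_inner_self_eq_norm_sq, ← ContinuousLinearMap.adjoint_inner_right,
        hsa.adjoint_eq, ← mul_apply_eq_comp, hA, ← map_mul,
        CFC.sqrt_mul_sqrt_self _ hS0.nonneg]
    have h2 : 0 ≤ inner ℝ y (Matrix.toEuclideanCLM (𝕜 := ℝ)
        (S - k • (1 : Matrix (Fin d) (Fin d) ℝ)) y) := by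
      rw [Matrix.inner_toEuclideanCLM]
      simpa using hS.dotProduct_mulVec_nonneg (y.ofLp)
    rw [map_sub, map_smul, map_one] at h2
    simp only [sub_apply, smul_apply, one_apply_eq_self, inner_sub_right, inner_smul_right,
      real_inner_self_eq_norm_sq] at h2
    linarith
  have hinj : Function.Injective (A : EuclideanSpace ℝ (Fin d) →ₗ[ℝ] EuclideanSpace ℝ (Fin d)) := by
    rw [injective_iff_map_eq_zero]
    intro y hy
    have := hAnorm y
    rw [show A y = 0 from hy] at this
    simp only [norm_zero, ne_eq, OfNat.ofNat_ne_zero, not_false_eq_true, zero_pow] at this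
    have h3 : ‖y‖ ^ 2 ≤ 0 := by
      by_contra! h
      nlinarith [mul_pos hk h]
    simpa using h3
  obtain ⟨a, ha⟩ := (LinearMap.injective_iff_surjective.1 hinj) (m + z - m')
  replace ha : A a = m + z - m' := ha
  have hAm : Measurable A := A.measurable
  rw [multivariateGaussian, multivariateGaussian, ← hA,
    lintegral_map (f := fun y => u (y + z)) (hu.comp (measurable_add_const z)) (hAm.const_add m),
    lintegral_map (hu.pow_const p) (hAm.const_add m')]
  have h4 : ∀ y, u (m + A y + z) = (fun y => u (m' + A y)) (a + y) := by
    intro y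
    simp only [map_add, ha]
    congr 1
    abel
  calc ∫⁻ y, u (m + A y + z) ∂(stdGaussian (EuclideanSpace ℝ (Fin d)))
      = ∫⁻ y, (fun y => u (m' + A y)) (a + y) ∂(stdGaussian (EuclideanSpace ℝ (Fin d))) := by
        simp_rw [h4]
    _ ≤ _ := lintegral_add_stdGaussian_le a hpq (hu.comp (hAm.const_add m'))
    _ ≤ _ := by
      have hq := hpq.symm.lt
      have h5 : ‖a‖ ^ 2 / 2 ≤ ‖m + z - m'‖ ^ 2 / (2 * k) := by
        rw [← ha, div_le_div_iff₀ (by positivity) (by positivity)]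
        linarith [hAnorm a]
      have hq' : 0 ≤ q - 1 := by linarith
      exact mul_le_mul' (ENNReal.ofReal_le_ofReal
        (Real.exp_le_exp.2 (mul_le_mul_of_nonneg_left h5 hq'))) le_rfl

end Gaussian

/-! ### Divergence bounds from inequalities for test functions -/

section Duality

variable {Ω : Type*} [MeasurableSpace Ω]

/-- The converse of Hölder's inequality: the bound on the `q`-th moment of the density comes from
the test functions `(min g n) ^ (q - 1)`, where `g` is the density. -/
theorem absolutelyContinuous_and_lintegral_rnDeriv_rpow_le {μ ν : Measure Ω}
    [IsFiniteMeasure μ] [IsFiniteMeasure ν] {p q : ℝ} (hpq : p.HolderConjugate q) {M : ℝ≥0∞}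
    (h : ∀ f : Ω → ℝ≥0∞, Measurable f →
      ∫⁻ x, f x ∂μ ≤ M ^ (1 / q) * (∫⁻ x, f x ^ p ∂ν) ^ (1 / p)) :
    μ ≪ ν ∧ ∫⁻ x, μ.rnDeriv ν x ^ q ∂ν ≤ M := by
  have hp := hpq.pos
  have hq := hpq.symm.pos
  have hac : μ ≪ ν := by
    refine Measure.AbsolutelyContinuous.mk fun s hs hνs => ?_
    have h1 := h (s.indicator 1) (measurable_one.indicator hs)
    have h2 : ∀ x, s.indicator (1 : Ω → ℝ≥0∞) x ^ p = s.indicator 1 x := by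
      intro x
      by_cases hx : x ∈ s <;> simp [hx, hp]
    simp_rw [h2] at h1
    rw [lintegral_indicator_one hs, lintegral_indicator_one hs, hνs,
      ENNReal.zero_rpow_of_pos (by positivity), mul_zero] at h1
    exact le_antisymm h1 bot_le
  refine ⟨hac, ?_⟩
  set g := μ.rnDeriv ν with hg
  have hgm : Measurable g := Measure.measurable_rnDeriv _ _
  have hmin : ∀ n : ℕ, Measurable fun x => min (g x) n := fun n => hgm.min measurable_const
  have key : ∀ n : ℕ, ∫⁻ x, min (g x) n ^ q ∂ν ≤ M := by
    intro n
    -- the truncation makes `I` finite, so that a power of it can be cancelled from `h5` below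
    set I := ∫⁻ x, min (g x) n ^ q ∂ν with hI
    have hIfin : I ≠ ∞ := by
      refine ne_top_of_le_ne_top ?_ (lintegral_mono (g := fun _ => (n : ℝ≥0∞) ^ q) fun x =>
        ENNReal.rpow_le_rpow (min_le_right _ _) hq.le)
      rw [lintegral_const]
      exact ENNReal.mul_ne_top (ENNReal.rpow_ne_top_of_nonneg hq.le (by simp)) (by simp)
    have h1 := h (fun x => min (g x) n ^ (q - 1)) ((hmin n).pow_const _)
    have h2 : ∀ x, (min (g x) n ^ (q - 1)) ^ p = min (g x) n ^ q := by
      intro x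
      rw [← ENNReal.rpow_mul, hpq.symm.sub_one_mul_conj]
    simp_rw [h2] at h1
    rw [← hI, ← lintegral_rnDeriv_mul hac ((hmin n).pow_const _).aemeasurable, ← hg] at h1
    have h3 : I ≤ ∫⁻ x, g x * min (g x) n ^ (q - 1) ∂ν := by
      refine lintegral_mono fun x => ?_
      have hne : min (g x) (n : ℝ≥0∞) ≠ ∞ := ne_top_of_le_ne_top (by simp) (min_le_right _ _)
      calc min (g x) (n : ℝ≥0∞) ^ q = min (g x) (n : ℝ≥0∞) ^ (1 + (q - 1)) := by ring_nf
        _ = min (g x) (n : ℝ≥0∞) * min (g x) (n : ℝ≥0∞) ^ (q - 1) := by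
            rw [ENNReal.rpow_add_of_nonneg _ _ (by norm_num) hpq.symm.sub_one_pos.le,
              ENNReal.rpow_one]
        _ ≤ _ := by gcongr; exact min_le_left _ _
    have h4 : I ≤ M ^ (1 / q) * I ^ (1 / p) := h3.trans h1
    rcases eq_or_ne I 0 with h0 | h0
    · simp [h0]
    have h5 : I ^ (1 / q) * I ^ (1 / p) ≤ M ^ (1 / q) * I ^ (1 / p) := by
      rw [← ENNReal.rpow_add _ _ h0 hIfin]
      have : 1 / q + 1 / p = 1 := by
        simpa [one_div] using hpq.symm.inv_add_inv_eq_one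
      rwa [this, ENNReal.rpow_one]
    have h6 := (ENNReal.mul_le_mul_iff_left (by simp [h0, hIfin])
      (ENNReal.rpow_ne_top_of_nonneg (by positivity) hIfin)).1 h5
    exact (ENNReal.rpow_le_rpow_iff (by positivity)).1 h6
  have hlim : Filter.Tendsto (fun n : ℕ => ∫⁻ x, min (g x) n ^ q ∂ν) Filter.atTop
      (nhds (∫⁻ x, g x ^ q ∂ν)) := by
    refine lintegral_tendsto_of_tendsto_of_monotone
      (fun n => ((hmin n).pow_const _).aemeasurable) (ae_of_all _ fun x m n hmn => ?_)
      (ae_of_all _ fun x => ?_)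
    · exact ENNReal.rpow_le_rpow (min_le_min le_rfl (by exact_mod_cast hmn)) hq.le
    · have : Filter.Tendsto (fun n : ℕ => min (g x) (n : ℝ≥0∞)) Filter.atTop (nhds (g x)) := by
        simpa using (tendsto_const_nhds (x := g x)).min ENNReal.tendsto_nat_nhds_top
      exact (ENNReal.continuous_rpow_const.tendsto _).comp this
  exact le_of_tendsto' hlim key

/-- A linearized Donsker-Varadhan inequality between `P` and `Q` with constant `K`: for bounded
`g`, it reads `∫ g dP ≤ K + ∫ exp g dQ - 1`. Adding a bound `B` of `|g|` to both sides makes all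
terms nonnegative, so that the inequality can be stated, and mixed over parameters, with Lebesgue
integrals. -/
def DonskerVaradhanBound (P Q : Measure Ω) (K : ℝ≥0∞) : Prop :=
  ∀ (g : Ω → ℝ) (B : ℝ), Measurable g → (∀ x, |g x| ≤ B) →
    ∫⁻ x, ENNReal.ofReal (g x + B) ∂P + 1
      ≤ ENNReal.ofReal B + K + ∫⁻ x, ENNReal.ofReal (Real.exp (g x)) ∂Q

/-- Truncations of `log f` as test functions, where `f` is the density, and Fatou's lemma bound
the Kullback-Leibler divergence. -/
theorem klDiv_le_of_donskerVaradhanBound {P Q : Measure Ω} [IsProbabilityMeasure P]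
    [IsProbabilityMeasure Q] {K : ℝ≥0∞} (h : DonskerVaradhanBound P Q K) : klDiv P Q ≤ K := by
  rcases eq_or_ne K ∞ with rfl | hK
  · exact le_top
  have hac : P ≪ Q := by
    refine Measure.AbsolutelyContinuous.mk fun s hs hQs => ?_
    by_contra hPs
    have h1 : ∀ n : ℕ, (n : ℝ≥0∞) * P s ≤ K := by
      intro n
      have h2 := h (s.indicator fun _ => (n : ℝ)) n (measurable_const.indicator hs) (by
        intro x
        by_cases hx : x ∈ s <;> simp [hx])
      have h3 : ∀ x, ENNReal.ofReal (s.indicator (fun _ => (n : ℝ)) x + n)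
          = s.indicator (fun _ => (n : ℝ≥0∞)) x + n := by
        intro x
        by_cases hx : x ∈ s
        · simp [hx, ENNReal.ofReal_add]
        · simp [hx]
      have h4 : ∫⁻ x, ENNReal.ofReal (Real.exp (s.indicator (fun _ => (n : ℝ)) x)) ∂Q = 1 := by
        have : (fun x => ENNReal.ofReal (Real.exp (s.indicator (fun _ => (n : ℝ)) x)))
            =ᵐ[Q] fun _ => 1 := by
          filter_upwards [measure_eq_zero_iff_ae_notMem.1 hQs] with x hx
          simp [hx]
        rw [lintegral_congr_ae this]
        simp
      simp_rw [h3] at h2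
      rw [h4, lintegral_add_right _ measurable_const, lintegral_indicator_const hs, lintegral_const,
        measure_univ, mul_one, ENNReal.ofReal_natCast] at h2
      have h5 := (ENNReal.add_le_add_iff_right (by simp)).1 h2
      rw [add_comm] at h5
      exact (ENNReal.add_le_add_iff_left (by simp)).1 h5
    have h2 : Filter.Tendsto (fun n : ℕ => (n : ℝ≥0∞) * P s) Filter.atTop (nhds ∞) := by
      have := ENNReal.Tendsto.mul_const (b := P s) ENNReal.tendsto_nat_nhds_top (by simp)
      rwa [ENNReal.top_mul hPs] at this
    exact hK (top_le_iff.1 (le_of_tendsto' h2 h1))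
  rw [klDiv_eq_lintegral_klFun_of_ac hac]
  set f : Ω → ℝ := fun x => (P.rnDeriv Q x).toReal with hf
  have hfm : Measurable f := (Measure.measurable_rnDeriv _ _).ennreal_toReal
  have hf0 : ∀ x, 0 ≤ f x := fun x => ENNReal.toReal_nonneg
  -- `c n` is the density truncated to `[1 / (n + 1), n + 1]`
  set c : ℕ → Ω → ℝ := fun n x => max (1 / (n + 1 : ℝ)) (min (f x) (n + 1)) with hc
  have hcm : ∀ n, Measurable (c n) := fun n => measurable_const.max (hfm.min measurable_const)
  have hc1 : ∀ (n : ℕ) (x : Ω), 1 / (n + 1 : ℝ) ≤ c n x := fun n x => le_max_left _ _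
  have hcpos : ∀ (n : ℕ) (x : Ω), 0 < c n x := fun n x => lt_of_lt_of_le (by positivity) (hc1 n x)
  have hone : ∀ n : ℕ, 1 / (n + 1 : ℝ) ≤ 1 := fun n => by
    rw [div_le_one (by positivity)]; simp
  have hc2 : ∀ (n : ℕ) (x : Ω), c n x ≤ n + 1 := fun n x =>
    max_le ((hone n).trans (by simp)) (min_le_right _ _)
  set B : ℕ → ℝ := fun n => Real.log (n + 1) with hB
  have hB0 : ∀ n, 0 ≤ B n := fun n => Real.log_nonneg (by simp)
  have hlog : ∀ n x, |Real.log (c n x)| ≤ B n := by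
    intro n x
    rw [abs_le]
    refine ⟨?_, Real.log_le_log (hcpos n x) (hc2 n x)⟩
    have := Real.log_le_log (by positivity) (hc1 n x)
    rwa [one_div, Real.log_inv] at this
  set H : ℕ → Ω → ℝ := fun n x => f x * Real.log (c n x) - c n x + 1 with hH
  have hH0 : ∀ n x, 0 ≤ H n x := by
    intro n x
    -- `(f - c) log c ≥ 0`, because `c` lies between `f` and `1` wherever it differs from `f`
    have h1 : c n x * Real.log (c n x) ≤ f x * Real.log (c n x) := by
      rcases lt_or_ge (f x) (1 / (n + 1 : ℝ)) with h2 | h2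
      · have h3 : c n x = 1 / (n + 1 : ℝ) := max_eq_left ((min_le_left _ _).trans h2.le)
        rw [h3]
        exact mul_le_mul_of_nonpos_right h2.le (Real.log_nonpos (by positivity) (hone n))
      rcases le_or_gt (f x) (n + 1) with h4 | h4
      · have h3 : c n x = f x := by simp only [hc]; rw [min_eq_left h4, max_eq_right h2]
        rw [h3]
      · have h3 : c n x = n + 1 := by
          simp only [hc]; rw [min_eq_right h4.le, max_eq_right ((hone n).trans (by simp))]
        rw [h3]
        exact mul_le_mul_of_nonneg_right h4.le (hB0 n)
    have h2 := klFun_nonneg (hcpos n x).le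
    rw [klFun_apply] at h2
    simp only [hH]
    linarith
  have hHm : ∀ n, Measurable (H n) := fun n =>
    ((hfm.mul (Real.measurable_log.comp (hcm n))).sub (hcm n)).add_const _
  have hbound : ∀ n, ∫⁻ x, ENNReal.ofReal (H n x) ∂Q ≤ K := by
    intro n
    have h1 := h (fun x => Real.log (c n x)) (B n) (Real.measurable_log.comp (hcm n)) (hlog n)
    simp_rw [Real.exp_log (hcpos n _)] at h1
    have hlm : Measurable fun x => ENNReal.ofReal (Real.log (c n x) + B n) :=
      ((Real.measurable_log.comp (hcm n)).add_const _).ennreal_ofReal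
    have hPB : ∫⁻ x, P.rnDeriv Q x * ENNReal.ofReal (B n) ∂Q = ENNReal.ofReal (B n) := by
      rw [lintegral_mul_const _ (Measure.measurable_rnDeriv _ _), Measure.lintegral_rnDeriv hac,
        measure_univ, one_mul]
    -- the pointwise identity `H + c + f B = f (log c + B) + 1` between nonnegative functions
    have h2 : ∫⁻ x, ENNReal.ofReal (H n x) ∂Q + ∫⁻ x, ENNReal.ofReal (c n x) ∂Q
        + ENNReal.ofReal (B n) = ∫⁻ x, ENNReal.ofReal (Real.log (c n x) + B n) ∂P + 1 := by
      rw [← lintegral_rnDeriv_mul hac hlm.aemeasurable, ← hPB,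
        ← lintegral_add_left (hHm n).ennreal_ofReal,
        ← lintegral_add_left (f := fun x => ENNReal.ofReal (H n x) + ENNReal.ofReal (c n x))
          ((hHm n).ennreal_ofReal.add (hcm n).ennreal_ofReal)]
      rw [show (1 : ℝ≥0∞) = ∫⁻ _, 1 ∂Q by simp, ← lintegral_add_right _ measurable_const]
      refine lintegral_congr_ae ?_
      filter_upwards [P.rnDeriv_ne_top Q] with x hx
      have h3 : P.rnDeriv Q x = ENNReal.ofReal (f x) := (ENNReal.ofReal_toReal hx).symm
      have h4 : 0 ≤ Real.log (c n x) + B n := by linarith [(abs_le.1 (hlog n x)).1]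
      rw [h3, ← ENNReal.ofReal_add (hH0 n x) (hcpos n x).le, ← ENNReal.ofReal_mul (hf0 x),
        ← ENNReal.ofReal_mul (hf0 x), ← ENNReal.ofReal_one,
        ← ENNReal.ofReal_add (add_nonneg (hH0 n x) (hcpos n x).le)
          (mul_nonneg (hf0 x) (hB0 n)),
        ← ENNReal.ofReal_add (mul_nonneg (hf0 x) h4) zero_le_one]
      congr 1
      simp only [hH]
      ring
    rw [← h2, add_comm (ENNReal.ofReal (B n)) K, add_right_comm K, add_assoc, add_assoc K] at h1
    have h5 : ∫⁻ x, ENNReal.ofReal (c n x) ∂Q ≠ ∞ := by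
      refine ne_top_of_le_ne_top ?_ (lintegral_mono (g := fun _ => ENNReal.ofReal (n + 1))
        fun x => ENNReal.ofReal_le_ofReal (hc2 n x))
      simp
    exact (ENNReal.add_le_add_iff_right (by simp [h5])).1 h1
  -- where the density vanishes, `f log c = 0` however small `c` is, and `H n = 1 - c n`
  have hlim : ∀ x, Filter.Tendsto (fun n => ENNReal.ofReal (H n x)) Filter.atTop
      (nhds (ENNReal.ofReal (klFun (f x)))) := by
    intro x
    refine (ENNReal.continuous_ofReal.tendsto _).comp ?_
    rcases (hf0 x).eq_or_lt with h0 | h0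
    · have h1 : ∀ n, H n x = 1 - 1 / (n + 1 : ℝ) := by
        intro n
        have : c n x = 1 / (n + 1 : ℝ) := by
          simp only [hc, ← h0]
          exact max_eq_left ((min_le_left _ _).trans (by positivity))
        simp only [hH, this, ← h0]
        ring
      simp_rw [h1, ← h0, klFun_zero]
      simpa using tendsto_one_div_add_atTop_nhds_zero_nat.const_sub (1 : ℝ)
    · refine tendsto_const_nhds.congr' ?_
      obtain ⟨n₁, hn₁⟩ := exists_nat_ge (f x)
      obtain ⟨n₂, hn₂⟩ := exists_nat_one_div_lt h0
      filter_upwards [Filter.eventually_ge_atTop (max n₁ n₂)] with n hn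
      have h1 : f x ≤ n + 1 := by
        have : (n₁ : ℝ) ≤ n := by exact_mod_cast (le_max_left _ _).trans hn
        linarith
      have h2 : 1 / (n + 1 : ℝ) ≤ f x := by
        have : (n₂ : ℝ) ≤ n := by exact_mod_cast (le_max_right _ _).trans hn
        exact (one_div_le_one_div_of_le (by positivity) (by linarith)).trans hn₂.le
      have h3 : c n x = f x := by simp only [hc]; rw [min_eq_left h1, max_eq_right h2]
      simp only [hH, h3, klFun_apply]
      ring
  calc ∫⁻ x, ENNReal.ofReal (klFun (f x)) ∂Q
      = ∫⁻ x, Filter.liminf (fun n => ENNReal.ofReal (H n x)) Filter.atTop ∂Q := by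
        simp_rw [(hlim _).liminf_eq]
    _ ≤ Filter.liminf (fun n => ∫⁻ x, ENNReal.ofReal (H n x) ∂Q) Filter.atTop :=
        lintegral_liminf_le fun n => (hHm n).ennreal_ofReal
    _ ≤ K := Filter.liminf_le_of_le (by isBoundedDefault) fun b hb => by
        obtain ⟨n, hn⟩ := hb.exists
        exact hn.trans (hbound n)

/-- The Harnack inequalities `∫ f dP ≤ exp ((q - 1) C) (∫ f ^ p dQ) ^ (1 / p)` yield, for
`f = exp (g / p)` and by Jensen's inequality, `∫ g dP ≤ q C + log ∫ exp g dQ`; then `q → 1`. -/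
theorem donskerVaradhanBound_of_harnack {P Q : Measure Ω} [IsProbabilityMeasure P]
    [IsProbabilityMeasure Q] {C : ℝ} (hC : 0 ≤ C)
    (h : ∀ p q : ℝ, p.HolderConjugate q → ∀ f : Ω → ℝ≥0∞, Measurable f →
      ∫⁻ x, f x ∂P ≤ ENNReal.ofReal (Real.exp ((q - 1) * C)) * (∫⁻ x, f x ^ p ∂Q) ^ (1 / p)) :
    DonskerVaradhanBound P Q (ENNReal.ofReal C) := by
  intro g B hg hgB
  have hB0 : 0 ≤ B := by
    obtain ⟨x⟩ := nonempty_of_isProbabilityMeasure P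
    exact (abs_nonneg _).trans (hgB x)
  have hgi : Integrable g P := Integrable.of_bound hg.aestronglyMeasurable B (ae_of_all _ hgB)
  have hexp : ∀ t : ℝ, 0 ≤ t → ∀ R : Measure Ω, IsProbabilityMeasure R →
      Integrable (fun x => Real.exp (t * g x)) R := by
    intro t ht R _
    refine Integrable.of_bound (hg.const_mul t).exp.aestronglyMeasurable (Real.exp (t * B))
      (ae_of_all _ fun x => ?_)
    rw [Real.norm_eq_abs, Real.abs_exp, Real.exp_le_exp]
    exact mul_le_mul_of_nonneg_left (abs_le.1 (hgB x)).2 ht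
  have hexp1 : Integrable (fun x => Real.exp (g x)) Q := by
    simpa using hexp 1 zero_le_one Q inferInstance
  set m := ∫ x, g x ∂P with hm
  set Z := ∫ x, Real.exp (g x) ∂Q with hZ
  have hZ0 : 0 < Z := integral_exp_pos hexp1
  have key : ∀ q : ℝ, 1 < q → m ≤ q * C + Z - 1 := by
    intro q hq
    have hpq : (Real.conjExponent q).HolderConjugate q :=
      (Real.HolderConjugate.conjExponent hq).symm
    set p := Real.conjExponent q
    have hp := hpq.pos
    have h1 := h p q hpq (fun x => ENNReal.ofReal (Real.exp (1 / p * g x)))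
      (hg.const_mul _).exp.ennreal_ofReal
    have h2 : ∀ x, ENNReal.ofReal (Real.exp (1 / p * g x)) ^ p
        = ENNReal.ofReal (Real.exp (g x)) := by
      intro x
      rw [ENNReal.ofReal_rpow_of_pos (Real.exp_pos _), ← Real.exp_mul]
      congr 2
      field_simp
    simp_rw [h2] at h1
    rw [← ofReal_integral_eq_lintegral_ofReal (hexp _ (by positivity) P inferInstance)
        (ae_of_all _ fun _ => (Real.exp_pos _).le),
      ← ofReal_integral_eq_lintegral_ofReal hexp1 (ae_of_all _ fun _ => (Real.exp_pos _).le), ← hZ,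
      ENNReal.ofReal_rpow_of_pos hZ0, ← ENNReal.ofReal_mul (Real.exp_pos _).le,
      ENNReal.ofReal_le_ofReal_iff (by positivity)] at h1
    have h3 : Real.exp (1 / p * m) ≤ ∫ x, Real.exp (1 / p * g x) ∂P := by
      have := convexOn_exp.map_integral_le (μ := P) (f := fun x => 1 / p * g x)
        Real.continuous_exp.continuousOn isClosed_univ (ae_of_all _ fun _ => Set.mem_univ _)
        (hgi.const_mul _) (hexp _ (by positivity) P inferInstance)
      rwa [integral_const_mul] at this
    have h4 := h3.trans h1
    rw [Real.rpow_def_of_pos hZ0, ← Real.exp_add, Real.exp_le_exp] at h4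
    have h5 : m ≤ p * ((q - 1) * C) + Real.log Z := by
      have := mul_le_mul_of_nonneg_left h4 hp.le
      field_simp at this
      linarith
    have h6 : p * ((q - 1) * C) = q * C := by
      rw [← mul_assoc, mul_comm p, hpq.symm.sub_one_mul_conj]
    have := Real.log_le_sub_one_of_pos hZ0
    linarith
  have hfin : m ≤ C + Z - 1 := by
    refine le_of_forall_pos_le_add fun ε hε => ?_
    have h1 := key (1 + ε / (C + 1)) (by simp; positivity)
    have h2 : ε / (C + 1) * C ≤ ε := by
      rw [div_mul_eq_mul_div, div_le_iff₀ (by positivity)]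
      nlinarith
    linarith
  have h0 : ∀ x, 0 ≤ g x + B := fun x => by linarith [(abs_le.1 (hgB x)).1]
  rw [← ofReal_integral_eq_lintegral_ofReal (f := fun x => g x + B)
      (hgi.add (integrable_const B)) (ae_of_all _ h0),
    ← ofReal_integral_eq_lintegral_ofReal hexp1 (ae_of_all _ fun _ => (Real.exp_pos _).le), ← hZ,
    ← ENNReal.ofReal_add hB0 hC, ← ENNReal.ofReal_add (by positivity) hZ0.le, ← ENNReal.ofReal_one,
    ← ENNReal.ofReal_add (integral_nonneg h0) zero_le_one]
  refine ENNReal.ofReal_le_ofReal ?_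
  rw [integral_add hgi (integrable_const B)]
  simp only [integral_const, probReal_univ, smul_eq_mul, one_mul]
  linarith

end Duality

/-! ### The interpolating shifts -/

section Shifts

/-- The fraction of the total displacement reached after step `k` of `N`, for a per-step
contraction factor `r`. It solves `s (k + 1) - r * s k = r ^ (N - 1 - k) / ∑ j < N, r ^ (2 * j)`
with `s 0 = 0`, which minimizes the sum of the squares of the left-hand sides over `k < N`
subject to `s N = 1`. -/
def interpShift (r : ℝ) (N k : ℕ) : ℝ :=
  r ^ (N - k) * (∑ i ∈ Finset.range k, (r ^ 2) ^ i) / ∑ i ∈ Finset.range N, (r ^ 2) ^ i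

variable {r : ℝ} {N : ℕ}

theorem geom_sq_pos (hr : 0 < r) (hN : 1 ≤ N) : 0 < ∑ i ∈ Finset.range N, (r ^ 2) ^ i :=
  Finset.sum_pos (fun _ _ => by positivity) ⟨0, Finset.mem_range.2 hN⟩

theorem interpShift_zero : interpShift r N 0 = 0 := by simp [interpShift]

theorem interpShift_self (hr : 0 < r) (hN : 1 ≤ N) : interpShift r N N = 1 := by
  simp [interpShift, (geom_sq_pos hr hN).ne']

theorem interpShift_succ_sub (hr : 0 < r) (hN : 1 ≤ N) {k : ℕ} (hk : k < N) :
    interpShift r N (k + 1) - r * interpShift r N k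
      = r ^ (N - 1 - k) / ∑ i ∈ Finset.range N, (r ^ 2) ^ i := by
  have hS := (geom_sq_pos hr hN).ne'
  obtain ⟨m, rfl⟩ : ∃ m, N = k + 1 + m := ⟨N - (k + 1), by omega⟩
  unfold interpShift
  rw [show k + 1 + m - (k + 1) = m by omega, show k + 1 + m - k = m + 1 by omega,
    show k + 1 + m - 1 - k = m by omega, geom_sum_succ (n := k), pow_succ]
  field_simp
  ring

theorem interpShift_mono (hr : 0 < r) (hr1 : r ≤ 1) (hN : 1 ≤ N) : Monotone (interpShift r N) := by
  refine monotone_nat_of_le_succ fun k => ?_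
  have hS := geom_sq_pos hr hN
  unfold interpShift
  refine div_le_div_of_nonneg_right ?_ hS.le
  have hG0 : 0 ≤ ∑ i ∈ Finset.range k, (r ^ 2) ^ i := Finset.sum_nonneg fun _ _ => by positivity
  rcases lt_or_ge k N with hk | hk
  · obtain ⟨m, rfl⟩ : ∃ m, N = k + 1 + m := ⟨N - (k + 1), by omega⟩
    rw [show k + 1 + m - (k + 1) = m by omega, show k + 1 + m - k = m + 1 by omega,
      geom_sum_succ (n := k), pow_succ, mul_assoc]
    refine mul_le_mul_of_nonneg_left ?_ (by positivity)
    have h1 : (∑ i ∈ Finset.range k, (r ^ 2) ^ i) * (1 - r ^ 2) ≤ 1 := by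
      rw [geom_sum_mul_neg]
      have : 0 ≤ (r ^ 2) ^ k := by positivity
      linarith
    have h2 : 0 ≤ (∑ i ∈ Finset.range k, (r ^ 2) ^ i) * (1 - r) :=
      mul_nonneg hG0 (by linarith)
    nlinarith
  · rw [Nat.sub_eq_zero_of_le hk, Nat.sub_eq_zero_of_le (by omega), Finset.sum_range_succ]
    have : 0 ≤ (r ^ 2) ^ k := by positivity
    linarith

theorem interpShift_nonneg (hr : 0 < r) (hr1 : r ≤ 1) (hN : 1 ≤ N) (k : ℕ) :
    0 ≤ interpShift r N k := by
  rw [← interpShift_zero (r := r) (N := N)]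
  exact interpShift_mono hr hr1 hN (Nat.zero_le k)

theorem sum_sq_interpShift (hr : 0 < r) (hN : 1 ≤ N) :
    ∑ k ∈ Finset.range N, (interpShift r N (k + 1) - r * interpShift r N k) ^ 2
      = 1 / ∑ i ∈ Finset.range N, (r ^ 2) ^ i := by
  have hS := (geom_sq_pos hr hN).ne'
  have h1 : ∀ k ∈ Finset.range N, (interpShift r N (k + 1) - r * interpShift r N k) ^ 2
      = (r ^ 2) ^ (N - 1 - k) / (∑ i ∈ Finset.range N, (r ^ 2) ^ i) ^ 2 := by
    intro k hk
    rw [interpShift_succ_sub hr hN (Finset.mem_range.1 hk), div_pow, ← pow_mul, ← pow_mul,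
      mul_comm]
  rw [Finset.sum_congr rfl h1, ← Finset.sum_div, Finset.sum_range_reflect (fun i => (r ^ 2) ^ i)]
  field_simp

theorem regConst_eq {lam h : ℝ} (hr : 0 < r) (hr1 : r ≤ 1) (hN : 1 ≤ N) :
    regConst lam h r N = 1 / (2 * (lam * h * ∑ i ∈ Finset.range N, (r ^ 2) ^ i)) := by
  unfold regConst
  split_ifs with h1
  · simp [h1]
    ring
  · have h2 : r ^ 2 < 1 := by nlinarith [lt_of_le_of_ne hr1 h1]
    have h3 : r ^ 2 - 1 ≠ 0 := by linarith
    have h4 : 0 < 1 - (r ^ 2) ^ N := by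
      have := pow_lt_one₀ (sq_nonneg r) h2 (by omega : N ≠ 0)
      linarith
    have h5 : (r ^ 2) ^ N - 1 ≠ 0 := by linarith
    rw [geom_sum_eq h2.ne, pow_mul, ← neg_sub (r ^ 2) 1, ← neg_sub ((r ^ 2) ^ N) 1]
    rw [show 2 * (lam * h * (((r ^ 2) ^ N - 1) / (r ^ 2 - 1)))
        = (2 * lam * h * ((r ^ 2) ^ N - 1)) / (r ^ 2 - 1) by ring,
      one_div_div, mul_neg, neg_div_neg_eq]

theorem regConst_pos {lam h : ℝ} (hlam : 0 < lam) (hh : 0 < h) (hr : 0 < r) (hr1 : r ≤ 1)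
    (hN : 1 ≤ N) : 0 < regConst lam h r N := by
  rw [regConst_eq hr hr1 hN]
  have := geom_sq_pos hr hN
  positivity

end Shifts

/-! ### Harnack inequality for the iterated kernel -/

section Harnack

theorem lintegral_kernel_pow_succ {E : Type*} [MeasurableSpace E] (κ : Kernel E E) (n : ℕ) (x : E)
    {f : E → ℝ≥0∞} (hf : Measurable f) :
    ∫⁻ y, f y ∂((κ ^ (n + 1)) x) = ∫⁻ z, ∫⁻ y, f y ∂((κ ^ n) z) ∂(κ x) := by
  rw [Kernel.pow_add, pow_one, Kernel.lintegral_comp _ _ _ hf]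

/-- A Harnack inequality for shifts, iterated along a kernel: if one step turns the shift `s • w` at
the starting point into the shift `t • w` at the end point at the cost `(t - r * s) ^ 2 * A`, then
`n` steps along a monotone sequence of shifts cost the sum of the single costs. -/
theorem lintegral_kernel_pow_add_le {E : Type*} [NormedAddCommGroup E] [NormedSpace ℝ E]
    [MeasurableSpace E] [BorelSpace E] [SecondCountableTopology E] (κ : Kernel E E)
    {p q r A : ℝ} (hpq : p.HolderConjugate q) (w : E)
    (hstep : ∀ (x : E) (s t : ℝ), 0 ≤ s → s ≤ t → ∀ u : E → ℝ≥0∞, Measurable u →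
      ∫⁻ y, u (y + t • w) ∂(κ x) ≤ ENNReal.ofReal (Real.exp ((q - 1) * ((t - r * s) ^ 2 * A)))
        * (∫⁻ y, u y ^ p ∂(κ (x + s • w))) ^ (1 / p))
    (n : ℕ) (s : ℕ → ℝ) (hs0 : 0 ≤ s 0) (hs : Monotone s) (x : E)
    {f : E → ℝ≥0∞} (hf : Measurable f) :
    ∫⁻ y, f (y + s n • w) ∂((κ ^ n) x)
      ≤ ENNReal.ofReal (Real.exp ((q - 1) *
          ((∑ k ∈ Finset.range n, (s (k + 1) - r * s k) ^ 2) * A)))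
        * (∫⁻ y, f y ^ p ∂((κ ^ n) (x + s 0 • w))) ^ (1 / p) := by
  induction n generalizing s x with
  | zero =>
    have hp := hpq.pos.ne'
    have hid : ∀ x, (κ ^ 0) x = Measure.dirac x := fun x => Kernel.id_apply x
    rw [hid, hid, lintegral_dirac' (f := fun y => f (y + s 0 • w)) _
        (hf.comp (measurable_add_const _)),
      lintegral_dirac' _ (hf.pow_const p), ← ENNReal.rpow_mul]
    simp [hp]
  | succ n ih =>
    have hp := hpq.pos.ne'
    set H : E → ℝ≥0∞ := fun z => ∫⁻ y, f y ^ p ∂((κ ^ n) z) with hH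
    have hHm : Measurable H := (hf.pow_const p).lintegral_kernel
    set a := Real.exp ((q - 1) * ((∑ k ∈ Finset.range n,
      (s (k + 1 + 1) - r * s (k + 1)) ^ 2) * A))
    rw [lintegral_kernel_pow_succ κ n x (f := fun y => f (y + s (n + 1) • w))
        (hf.comp (measurable_add_const _)),
      lintegral_kernel_pow_succ κ n _ (hf.pow_const p)]
    calc ∫⁻ z, ∫⁻ y, f (y + s (n + 1) • w) ∂((κ ^ n) z) ∂(κ x)
        ≤ ∫⁻ z, ENNReal.ofReal a * H (z + s 1 • w) ^ (1 / p) ∂(κ x) :=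
          lintegral_mono fun z => ih (fun k => s (k + 1)) (hs0.trans (hs (by simp)))
            (fun i j hij => hs (by omega)) z
      _ = ENNReal.ofReal a * ∫⁻ z, H (z + s 1 • w) ^ (1 / p) ∂(κ x) :=
          lintegral_const_mul _ ((hHm.comp (measurable_add_const _)).pow_const _)
      _ ≤ ENNReal.ofReal a * (ENNReal.ofReal (Real.exp ((q - 1) * ((s 1 - r * s 0) ^ 2 * A)))
          * (∫⁻ z, (H z ^ (1 / p)) ^ p ∂(κ (x + s 0 • w))) ^ (1 / p)) := by
          gcongr
          exact hstep x (s 0) (s 1) hs0 (hs (by simp)) (fun z => H z ^ (1 / p)) (hHm.pow_const _)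
      _ = _ := by
          rw [← mul_assoc, ← ENNReal.ofReal_mul (Real.exp_pos _).le, ← Real.exp_add]
          have h1 : ∀ z, (H z ^ (1 / p)) ^ p = H z := fun z => by
            rw [← ENNReal.rpow_mul, one_div_mul_cancel hp, ENNReal.rpow_one]
          simp_rw [h1]
          rw [Finset.sum_range_succ' (fun k => (s (k + 1) - r * s k) ^ 2)]
          congr 4
          ring

variable {d m : ℕ} {L : ℝ≥0} {lam h : ℝ}
  {b : EuclideanSpace ℝ (Fin d) → EuclideanSpace ℝ (Fin d)} {σ : Matrix (Fin d) (Fin m) ℝ}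

instance isMarkovKernel_eulerKernel (hb : Measurable b) :
    IsMarkovKernel (eulerKernel b hb σ h) where
  isProbabilityMeasure x := by
    change IsProbabilityMeasure (multivariateGaussian _ _)
    infer_instance

instance isMarkovKernel_pow {E : Type*} [MeasurableSpace E] (κ : Kernel E E) [IsMarkovKernel κ]
    (n : ℕ) : IsMarkovKernel (κ ^ n) := by
  induction n with
  | zero => exact inferInstanceAs (IsMarkovKernel Kernel.id)
  | succ n ih =>
    rw [Kernel.pow_add, pow_one]
    infer_instance

instance isProbabilityMeasure_eulerLaw (hb : Measurable b) (N : ℕ)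
    (μ : Measure (EuclideanSpace ℝ (Fin d))) [IsProbabilityMeasure μ] :
    IsProbabilityMeasure (eulerLaw b hb σ h N μ) := by
  unfold eulerLaw
  infer_instance

/-- The shift `s • w` of the starting point is carried by the drift to a shift that differs from
`t • w` by at most `(t - r * s) * ‖w‖` with `r = 1 - L * h`; the Gaussian noise absorbs the
difference. -/
theorem lintegral_eulerKernel_add_le (hlam : 0 < lam) (hh : 0 < h) (hb : LipschitzWith L b)
    (hσ : (σ * σᵀ - lam • (1 : Matrix (Fin d) (Fin d) ℝ)).PosSemidef) {p q : ℝ}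
    (hpq : p.HolderConjugate q) (w x : EuclideanSpace ℝ (Fin d)) {s t : ℝ} (hs : 0 ≤ s)
    (hst : s ≤ t) {u : EuclideanSpace ℝ (Fin d) → ℝ≥0∞} (hu : Measurable u) :
    ∫⁻ y, u (y + t • w) ∂(eulerKernel b hb.continuous.measurable σ h x)
      ≤ ENNReal.ofReal (Real.exp ((q - 1) *
          ((t - (1 - L * h) * s) ^ 2 * (‖w‖ ^ 2 / (2 * (h * lam))))))
        * (∫⁻ y, u y ^ p
            ∂(eulerKernel b hb.continuous.measurable σ h (x + s • w))) ^ (1 / p) := by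
  have hS : (h • (σ * σᵀ) - (h * lam) • (1 : Matrix (Fin d) (Fin d) ℝ)).PosSemidef := by
    rw [mul_smul, ← smul_sub]
    exact hσ.smul hh.le
  refine (lintegral_add_multivariateGaussian_le (mul_pos hh hlam) hS (x + h • b x)
    (x + s • w + h • b (x + s • w)) (t • w) hpq hu).trans ?_
  have hδ : ‖x + h • b x + t • w - (x + s • w + h • b (x + s • w))‖
      ≤ (t - (1 - L * h) * s) * ‖w‖ := by
    have h1 : x + h • b x + t • w - (x + s • w + h • b (x + s • w))
        = (t - s) • w + h • (b x - b (x + s • w)) := by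
      rw [sub_smul, smul_sub]
      abel
    have h2 : ‖b x - b (x + s • w)‖ ≤ L * (s * ‖w‖) := by
      refine (hb.norm_sub_le _ _).trans_eq ?_
      rw [sub_add_cancel_left, norm_neg, norm_smul, Real.norm_of_nonneg hs]
    rw [h1]
    refine (norm_add_le _ _).trans ?_
    rw [norm_smul, norm_smul, Real.norm_of_nonneg (sub_nonneg.2 hst), Real.norm_of_nonneg hh.le]
    nlinarith [mul_le_mul_of_nonneg_left h2 hh.le]
  have hsq : ‖x + h • b x + t • w - (x + s • w + h • b (x + s • w))‖ ^ 2 / (2 * (h * lam))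
      ≤ (t - (1 - L * h) * s) ^ 2 * (‖w‖ ^ 2 / (2 * (h * lam))) := by
    rw [← mul_div_assoc, ← mul_pow]
    exact div_le_div_of_nonneg_right (pow_le_pow_left₀ (norm_nonneg _) hδ 2) (by positivity)
  exact mul_le_mul' (ENNReal.ofReal_le_ofReal (Real.exp_le_exp.2
    (mul_le_mul_of_nonneg_left hsq hpq.symm.sub_one_pos.le))) le_rfl

/-- The shift-Harnack inequality for `N` Euler steps, along the optimal shifts. -/
theorem lintegral_eulerKernel_pow_add_le (hlam : 0 < lam) (hh : 0 < h) (hLh : (L : ℝ) * h < 1)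
    {N : ℕ} (hN : 1 ≤ N) (hb : LipschitzWith L b)
    (hσ : (σ * σᵀ - lam • (1 : Matrix (Fin d) (Fin d) ℝ)).PosSemidef) {p q : ℝ}
    (hpq : p.HolderConjugate q) (x v v' : EuclideanSpace ℝ (Fin d))
    {f : EuclideanSpace ℝ (Fin d) → ℝ≥0∞} (hf : Measurable f) :
    ∫⁻ y, f (y + v) ∂((eulerKernel b hb.continuous.measurable σ h ^ N) x)
      ≤ ENNReal.ofReal (Real.exp ((q - 1) * (regConst lam h (1 - L * h) N * ‖v - v'‖ ^ 2)))
        * (∫⁻ y, f (y + v') ^ p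
            ∂((eulerKernel b hb.continuous.measurable σ h ^ N) x)) ^ (1 / p) := by
  set r : ℝ := 1 - L * h with hr
  have hr0 : 0 < r := by linarith
  have hr1 : r ≤ 1 := by
    have : 0 ≤ (L : ℝ) * h := mul_nonneg L.2 hh.le
    linarith
  have key := lintegral_kernel_pow_add_le (eulerKernel b hb.continuous.measurable σ h) hpq (v - v')
    (fun x s t hs hst u hu => lintegral_eulerKernel_add_le hlam hh hb hσ hpq (v - v') x hs hst hu)
    N (interpShift r N) (interpShift_nonneg hr0 hr1 hN 0) (interpShift_mono hr0 hr1 hN) x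
    (f := fun y => f (y + v')) (hf.comp (measurable_add_const _))
  simp only [interpShift_self hr0 hN, interpShift_zero, one_smul, zero_smul, add_zero,
    ← hr, sum_sq_interpShift hr0 hN, add_assoc, sub_add_cancel] at key
  refine key.trans_eq ?_
  rw [regConst_eq hr0 hr1 hN]
  have hS := (geom_sq_pos hr0 hN).ne'
  congr 4
  field_simp

end Harnack

/-! ### From translates to couplings -/

section Couplings

variable {E : Type*} [NormedAddCommGroup E] [MeasurableSpace E]

/-- The shift-Harnack inequality with constant `c`: translates of `ρ` by `v` and `v'` satisfy the
dual form of the Rényi bound `R_q ≤ q c ‖v - v'‖²` for all `q > 1`. -/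
def ShiftHarnack (ρ : Measure E) (c : ℝ) : Prop :=
  ∀ p q : ℝ, p.HolderConjugate q → ∀ (v v' : E) (f : E → ℝ≥0∞), Measurable f →
    ∫⁻ y, f (y + v) ∂ρ ≤ ENNReal.ofReal (Real.exp ((q - 1) * (c * ‖v - v'‖ ^ 2)))
      * (∫⁻ y, f (y + v') ^ p ∂ρ) ^ (1 / p)

theorem lintegral_rpow_inv_le {Ω : Type*} [MeasurableSpace Ω] {μ : Measure Ω}
    [IsProbabilityMeasure μ] {p q : ℝ} (hpq : p.HolderConjugate q) {f : Ω → ℝ≥0∞}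
    (hf : Measurable f) : ∫⁻ x, f x ^ (1 / p) ∂μ ≤ (∫⁻ x, f x ∂μ) ^ (1 / p) := by
  have h := ENNReal.lintegral_mul_le_Lp_mul_Lq μ hpq (f := fun x => f x ^ (1 / p)) (g := 1)
    (hf.pow_const _).aemeasurable measurable_one.aemeasurable
  have h1 : ∀ x, (f x ^ (1 / p)) ^ p = f x := fun x => by
    rw [← ENNReal.rpow_mul, one_div_mul_cancel hpq.ne_zero, ENNReal.rpow_one]
  simp_rw [h1] at h
  simpa using h

/-- The Harnack inequality for deterministic starting points passes to random ones by Jensen's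
inequality. -/
theorem shiftHarnack_bind [BorelSpace E] [SecondCountableTopology E] {K : Kernel E E} {c : ℝ}
    (hK : ∀ x, ShiftHarnack (K x) c) (μ : Measure E) [IsProbabilityMeasure μ] :
    ShiftHarnack (μ.bind K) c := by
  intro p q hpq v v' f hf
  have hm : ∀ v : E, Measurable fun y => f (y + v) := fun v => hf.comp (measurable_add_const v)
  rw [Measure.lintegral_bind K.measurable.aemeasurable (hm v).aemeasurable,
    Measure.lintegral_bind K.measurable.aemeasurable ((hm v').pow_const p).aemeasurable]
  have hU : Measurable fun x => ∫⁻ y, f (y + v') ^ p ∂(K x) :=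
    ((hm v').pow_const p).lintegral_kernel
  refine (lintegral_mono fun x => hK x p q hpq v v' f hf).trans ?_
  rw [lintegral_const_mul _ (hU.pow_const _)]
  exact mul_le_mul' le_rfl (lintegral_rpow_inv_le hpq hU)

theorem lintegral_conv_map [BorelSpace E] [SecondCountableTopology E] {Ω : Type*}
    [MeasurableSpace Ω] {γ : Measure Ω} {φ : Ω → E} (hφ : Measurable φ) (ρ : Measure E)
    [SFinite ρ] [SFinite γ] {f : E → ℝ≥0∞} (hf : Measurable f) :
    ∫⁻ z, f z ∂(ρ ∗ γ.map φ) = ∫⁻ ω, ∫⁻ y, f (y + φ ω) ∂ρ ∂γ := by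
  have hm : Measurable fun p : E × E => f (p.2 + p.1) :=
    hf.comp (measurable_snd.add measurable_fst)
  rw [Measure.conv_comm, Measure.lintegral_conv hf]
  have hcomm : ∀ x, ∫⁻ y, f (x + y) ∂ρ = ∫⁻ y, f (y + x) ∂ρ := fun x => by simp_rw [add_comm x]
  simp_rw [hcomm]
  rw [lintegral_map (f := fun x => ∫⁻ y, f (y + x) ∂ρ) hm.lintegral_prod_right' hφ]

theorem isProbabilityMeasure_of_mem_couplings {X : Type*} [MeasurableSpace X] {ν ν' : Measure X}
    [IsProbabilityMeasure ν] {γ : Measure (X × X)} (hγ : γ ∈ couplings ν ν') :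
    IsProbabilityMeasure γ := by
  constructor
  rw [← measure_univ (μ := ν), ← hγ.1, Measure.map_apply measurable_fst MeasurableSet.univ,
    Set.preimage_univ]

/-- The two values at singular pairs agree: both definitions give `∞` if `μ` is not absolutely
continuous with respect to `ν`. -/
theorem renyiDiv_one {Ω : Type*} [MeasurableSpace Ω] (μ ν : Measure Ω) :
    renyiDiv 1 μ ν = (klDiv μ ν : EReal) := by
  by_cases h : μ ≪ ν <;> simp [renyiDiv, h]

theorem renyiDiv_of_one_lt {Ω : Type*} [MeasurableSpace Ω] {μ ν : Measure Ω} {q : ℝ} (hq : 1 < q)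
    (h : μ ≪ ν) : renyiDiv q μ ν
      = ((1 / (q - 1) : ℝ) : EReal) * ENNReal.log (∫⁻ x, (μ.rnDeriv ν x) ^ q ∂ν) := by
  rw [renyiDiv, if_pos h, if_neg hq.ne']

/-- The Donsker-Varadhan inequalities for pairs of translates are integrated over the coupling. -/
theorem klDiv_conv_le [BorelSpace E] [SecondCountableTopology E] {ρ ν ν' : Measure E}
    [IsProbabilityMeasure ρ] [IsProbabilityMeasure ν] [IsProbabilityMeasure ν'] {c : ℝ}
    (hc : 0 ≤ c) (hρ : ShiftHarnack ρ c) {γ : Measure (E × E)} (hγ : γ ∈ couplings ν ν') :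
    klDiv (ρ ∗ ν) (ρ ∗ ν') ≤ ENNReal.ofReal c * quadraticCost γ := by
  have := isProbabilityMeasure_of_mem_couplings hγ
  refine klDiv_le_of_donskerVaradhanBound fun g B hg hgB => ?_
  have hgm : Measurable fun x => ENNReal.ofReal (g x + B) := (hg.add_const B).ennreal_ofReal
  have hem : Measurable fun x => ENNReal.ofReal (Real.exp (g x)) := hg.exp.ennreal_ofReal
  have hcost : Measurable fun p : E × E => ENNReal.ofReal (‖p.1 - p.2‖ ^ 2) := by fun_prop
  have hU : Measurable fun p : E × E => ∫⁻ y, ENNReal.ofReal (Real.exp (g (y + p.2))) ∂ρ :=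
    Measurable.lintegral_prod_right' (f := fun z : (E × E) × E =>
      ENNReal.ofReal (Real.exp (g (z.2 + z.1.2)))) (hem.comp (by fun_prop))
  have hpt : ∀ p : E × E, ∫⁻ y, ENNReal.ofReal (g (y + p.1) + B) ∂ρ + 1
      ≤ ENNReal.ofReal B + ENNReal.ofReal c * ENNReal.ofReal (‖p.1 - p.2‖ ^ 2)
        + ∫⁻ y, ENNReal.ofReal (Real.exp (g (y + p.2))) ∂ρ := by
    intro p
    have hadd : ∀ v : E, Measurable fun y => y + v := fun v => measurable_add_const v
    have h1 : ∀ v : E, IsProbabilityMeasure (ρ.map fun y => y + v) := fun v =>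
      Measure.isProbabilityMeasure_map (hadd v).aemeasurable
    have h2 : DonskerVaradhanBound (ρ.map fun y => y + p.1) (ρ.map fun y => y + p.2)
        (ENNReal.ofReal (c * ‖p.1 - p.2‖ ^ 2)) := by
      refine donskerVaradhanBound_of_harnack (by positivity) fun a q haq f hf => ?_
      rw [lintegral_map hf (hadd _), lintegral_map (hf.pow_const a) (hadd _)]
      exact hρ a q haq p.1 p.2 f hf
    have h3 := h2 g B hg hgB
    rwa [lintegral_map hgm (hadd _), lintegral_map hem (hadd _), ENNReal.ofReal_mul hc] at h3
  have h1 := lintegral_conv_map (γ := γ) measurable_fst ρ hgm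
  have h2 := lintegral_conv_map (γ := γ) measurable_snd ρ hem
  rw [hγ.1] at h1
  rw [hγ.2] at h2
  rw [h1, h2]
  calc ∫⁻ p, ∫⁻ y, ENNReal.ofReal (g (y + p.1) + B) ∂ρ ∂γ + 1
      = ∫⁻ p, (∫⁻ y, ENNReal.ofReal (g (y + p.1) + B) ∂ρ + 1) ∂γ := by
        rw [lintegral_add_right _ measurable_const]
        simp
    _ ≤ _ := lintegral_mono hpt
    _ = _ := by
        rw [lintegral_add_right _ hU, lintegral_add_right _ (hcost.const_mul _),
          lintegral_const_mul _ hcost]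
        simp [quadraticCost]

/-- Hölder's inequality with respect to the coupling integrates the Harnack inequalities. -/
theorem absolutelyContinuous_conv_and_lintegral_rpow_le [BorelSpace E] [SecondCountableTopology E]
    {ρ ν ν' : Measure E} [IsProbabilityMeasure ρ] [IsProbabilityMeasure ν]
    [IsProbabilityMeasure ν'] {c : ℝ} (hρ : ShiftHarnack ρ c) {γ : Measure (E × E)}
    (hγ : γ ∈ couplings ν ν') {q : ℝ} (hq : 1 < q) :
    ρ ∗ ν ≪ ρ ∗ ν' ∧ ∫⁻ x, (ρ ∗ ν).rnDeriv (ρ ∗ ν') x ^ q ∂(ρ ∗ ν')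
      ≤ ∫⁻ z, ENNReal.ofReal (Real.exp (q * (q - 1) * c * ‖z.1 - z.2‖ ^ 2)) ∂γ := by
  obtain ⟨p, hpq⟩ : ∃ p : ℝ, p.HolderConjugate q := ⟨_, (Real.HolderConjugate.conjExponent hq).symm⟩
  have := isProbabilityMeasure_of_mem_couplings hγ
  refine absolutelyContinuous_and_lintegral_rnDeriv_rpow_le hpq fun f hf => ?_
  have h1 := lintegral_conv_map (γ := γ) measurable_fst ρ hf
  have h2 := lintegral_conv_map (γ := γ) measurable_snd ρ (hf.pow_const p)
  rw [hγ.1] at h1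
  rw [hγ.2] at h2
  rw [h1, h2]
  have hem : Measurable fun z : E × E =>
      ENNReal.ofReal (Real.exp ((q - 1) * (c * ‖z.1 - z.2‖ ^ 2))) := by fun_prop
  have hm : Measurable fun z : (E × E) × E => f (z.2 + z.1.2) ^ p :=
    (hf.comp (measurable_snd.add measurable_fst.snd)).pow_const p
  have hU : Measurable fun z : E × E => ∫⁻ y, f (y + z.2) ^ p ∂ρ := hm.lintegral_prod_right'
  have hpt : ∀ z : E × E, ∫⁻ y, f (y + z.1) ∂ρ
      ≤ ENNReal.ofReal (Real.exp ((q - 1) * (c * ‖z.1 - z.2‖ ^ 2)))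
        * (∫⁻ y, f (y + z.2) ^ p ∂ρ) ^ (1 / p) := fun z => hρ p q hpq z.1 z.2 f hf
  refine (lintegral_mono hpt).trans ?_
  refine (ENNReal.lintegral_mul_le_Lp_mul_Lq γ hpq.symm hem.aemeasurable
    (hU.pow_const (1 / p)).aemeasurable).trans_eq ?_
  have h3 : ∀ z : E × E, ENNReal.ofReal (Real.exp ((q - 1) * (c * ‖z.1 - z.2‖ ^ 2))) ^ q
      = ENNReal.ofReal (Real.exp (q * (q - 1) * c * ‖z.1 - z.2‖ ^ 2)) := by
    intro z
    rw [ENNReal.ofReal_rpow_of_pos (Real.exp_pos _), ← Real.exp_mul]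
    ring_nf
  have h4 : ∀ z : E × E, ((∫⁻ y, f (y + z.2) ^ p ∂ρ) ^ (1 / p)) ^ p
      = ∫⁻ y, f (y + z.2) ^ p ∂ρ := by
    intro z
    rw [← ENNReal.rpow_mul, one_div_mul_cancel hpq.ne_zero, ENNReal.rpow_one]
  simp_rw [h3, h4]

theorem renyiDiv_conv_le [BorelSpace E] [SecondCountableTopology E] {ρ ν ν' : Measure E}
    [IsProbabilityMeasure ρ] [IsProbabilityMeasure ν] [IsProbabilityMeasure ν'] {c : ℝ}
    (hc : 0 ≤ c) (hρ : ShiftHarnack ρ c) {γ : Measure (E × E)} (hγ : γ ∈ couplings ν ν') {q : ℝ}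
    (hq : 1 ≤ q) : renyiDiv q (ρ ∗ ν) (ρ ∗ ν') ≤ renyiCost q c γ := by
  rcases hq.eq_or_lt with rfl | hq
  · rw [renyiDiv_one, renyiCost, if_pos rfl, EReal.coe_ennreal_le_coe_ennreal_iff]
    exact klDiv_conv_le hc hρ hγ
  obtain ⟨hac, hle⟩ := absolutelyContinuous_conv_and_lintegral_rpow_le hρ hγ hq
  rw [renyiDiv_of_one_lt hq hac, renyiCost, if_neg hq.ne']
  have h0 : (0 : EReal) ≤ ((1 / (q - 1) : ℝ) : EReal) :=
    EReal.coe_nonneg.2 (one_div_nonneg.2 (by linarith))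
  exact mul_le_mul_of_nonneg_left (ENNReal.log_monotone hle) h0

theorem wasserstein2_sq (ν ν' : Measure E) :
    wasserstein2 ν ν' ^ 2 = ⨅ γ ∈ couplings ν ν', quadraticCost γ := by
  rw [wasserstein2, ← ENNReal.rpow_natCast, ← ENNReal.rpow_mul]
  norm_num

theorem klDiv_conv_le_wasserstein2 [BorelSpace E] [SecondCountableTopology E] {ρ ν ν' : Measure E}
    [IsProbabilityMeasure ρ] [IsProbabilityMeasure ν] [IsProbabilityMeasure ν'] {c : ℝ}
    (hc : 0 < c) (hρ : ShiftHarnack ρ c) :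
    klDiv (ρ ∗ ν) (ρ ∗ ν') ≤ ENNReal.ofReal c * wasserstein2 ν ν' ^ 2 := by
  rw [wasserstein2_sq, mul_comm, ← ENNReal.div_le_iff (by simpa using hc) (by simp)]
  refine le_iInf₂ fun γ hγ => ?_
  rw [ENNReal.div_le_iff (by simpa using hc) (by simp), mul_comm]
  exact klDiv_conv_le hc.le hρ hγ

theorem dirac_mem_couplings {X : Type*} [MeasurableSpace X] (v v' : X) :
    Measure.dirac (v, v') ∈ couplings (Measure.dirac v) (Measure.dirac v') :=
  ⟨Measure.map_dirac' measurable_fst _, Measure.map_dirac' measurable_snd _⟩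

/-- Two Dirac masses have only one coupling. -/
theorem eq_dirac_of_mem_couplings {X : Type*} [MeasurableSpace X] [MeasurableSingletonClass X]
    {v v' : X} {γ : Measure (X × X)}
    (hγ : γ ∈ couplings (Measure.dirac v) (Measure.dirac v')) : γ = Measure.dirac (v, v') := by
  have := isProbabilityMeasure_of_mem_couplings hγ
  have h1 : ∀ᵐ z ∂γ, z.1 = v := by
    refine ae_of_ae_map (μ := γ) (f := Prod.fst) (p := fun x => x = v)
      measurable_fst.aemeasurable ?_
    rw [hγ.1]
    exact (ae_dirac_iff (measurableSet_singleton v)).2 rfl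
  have h2 : ∀ᵐ z ∂γ, z.2 = v' := by
    refine ae_of_ae_map (μ := γ) (f := Prod.snd) (p := fun x => x = v')
      measurable_snd.aemeasurable ?_
    rw [hγ.2]
    exact (ae_dirac_iff (measurableSet_singleton v')).2 rfl
  have h3 : (id : X × X → X × X) =ᵐ[γ] fun _ => (v, v') := by
    filter_upwards [h1, h2] with z hz1 hz2
    exact Prod.ext hz1 hz2
  have h4 : γ.map id = γ.map fun _ => (v, v') := Measure.map_congr h3
  rwa [Measure.map_id, Measure.map_const, measure_univ, one_smul] at h4

theorem couplings_dirac {X : Type*} [MeasurableSpace X] [MeasurableSingletonClass X] (v v' : X) :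
    couplings (Measure.dirac v) (Measure.dirac v') = {Measure.dirac (v, v')} :=
  Set.eq_singleton_iff_unique_mem.2
    ⟨dirac_mem_couplings v v', fun _ hγ => eq_dirac_of_mem_couplings hγ⟩

theorem wasserstein2_dirac_sq [BorelSpace E] [SecondCountableTopology E] (v v' : E) :
    wasserstein2 (Measure.dirac v) (Measure.dirac v') ^ 2 = ENNReal.ofReal (‖v - v'‖ ^ 2) := by
  rw [wasserstein2_sq, couplings_dirac, iInf_singleton, quadraticCost,
    lintegral_dirac' _ (by fun_prop)]

theorem renyiCost_dirac [BorelSpace E] [SecondCountableTopology E] {q c : ℝ} (hc : 0 ≤ c)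
    (hq : 1 ≤ q) (v v' : E) :
    renyiCost q c (Measure.dirac (v, v')) = ((q * c * ‖v - v'‖ ^ 2 : ℝ) : EReal) := by
  rcases hq.eq_or_lt with rfl | hq
  · rw [renyiCost, if_pos rfl, quadraticCost, lintegral_dirac' _ (by fun_prop),
      ← ENNReal.ofReal_mul hc, one_mul, EReal.coe_ennreal_ofReal, max_eq_left (by positivity)]
  · rw [renyiCost, if_neg hq.ne', lintegral_dirac' _ (by fun_prop),
      ENNReal.log_ofReal_of_pos (Real.exp_pos _), Real.log_exp, ← EReal.coe_mul]
    have : q - 1 ≠ 0 := by linarith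
    congr 1
    field_simp

end Couplings

/-! ### The Ornstein-Uhlenbeck kernel -/

section OrnsteinUhlenbeck

variable {d : ℕ}

theorem measurableEmbedding_affine (m : EuclideanSpace ℝ (Fin d)) {s : ℝ} (hs : s ≠ 0) :
    MeasurableEmbedding fun y : EuclideanSpace ℝ (Fin d) => m + s • y :=
  (measurableEmbedding_addLeft m).comp (measurableEmbedding_const_smul₀ hs)

/-- The Kullback-Leibler divergence between two translates of the standard Gaussian measure. -/
theorem klDiv_map_add_stdGaussian (a : EuclideanSpace ℝ (Fin d)) :
    klDiv ((stdGaussian (EuclideanSpace ℝ (Fin d))).map fun y => a + y)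
      (stdGaussian (EuclideanSpace ℝ (Fin d))) = ENNReal.ofReal (‖a‖ ^ 2 / 2) := by
  have hprob : IsProbabilityMeasure
      ((stdGaussian (EuclideanSpace ℝ (Fin d))).map fun y => a + y) :=
    Measure.isProbabilityMeasure_map (by fun_prop)
  have hac : (stdGaussian (EuclideanSpace ℝ (Fin d))).map (fun y => a + y)
      ≪ stdGaussian (EuclideanSpace ℝ (Fin d)) := by
    rw [map_add_stdGaussian]
    exact withDensity_absolutelyContinuous _ _
  have hllr : llr ((stdGaussian (EuclideanSpace ℝ (Fin d))).map fun y => a + y)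
      (stdGaussian (EuclideanSpace ℝ (Fin d)))
      =ᵐ[(stdGaussian (EuclideanSpace ℝ (Fin d))).map fun y => a + y]
        fun y => inner ℝ y a - ‖a‖ ^ 2 / 2 := by
    refine hac.ae_le ?_
    have h := Measure.rnDeriv_withDensity (stdGaussian (EuclideanSpace ℝ (Fin d)))
      (measurable_gaussianTilt a).ennreal_ofReal
    rw [← map_add_stdGaussian] at h
    filter_upwards [h] with y hy
    rw [llr, hy, gaussianTilt, ENNReal.toReal_ofReal (Real.exp_pos _).le, Real.log_exp]
  have hinner : Integrable (fun y : EuclideanSpace ℝ (Fin d) => inner ℝ y a)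
      (stdGaussian (EuclideanSpace ℝ (Fin d))) := by
    simp_rw [real_inner_comm a]
    exact IsGaussian.integrable_id.const_inner a
  have hzero : ∫ y, inner ℝ y a ∂(stdGaussian (EuclideanSpace ℝ (Fin d))) = 0 := by
    simp_rw [real_inner_comm a]
    rw [integral_inner (f := fun y => y) IsGaussian.integrable_id, integral_id_stdGaussian,
      inner_zero_right]
  have hexpand : ∀ y : EuclideanSpace ℝ (Fin d),
      inner ℝ (a + y) a - ‖a‖ ^ 2 / 2 = inner ℝ y a + ‖a‖ ^ 2 / 2 := by
    intro y
    rw [inner_add_left, real_inner_self_eq_norm_sq]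
    ring
  have hmeas : Measurable fun y : EuclideanSpace ℝ (Fin d) => inner ℝ y a - ‖a‖ ^ 2 / 2 := by
    fun_prop
  have hint : Integrable (fun y : EuclideanSpace ℝ (Fin d) => inner ℝ y a - ‖a‖ ^ 2 / 2)
      ((stdGaussian (EuclideanSpace ℝ (Fin d))).map fun y => a + y) := by
    rw [integrable_map_measure hmeas.aestronglyMeasurable (by fun_prop)]
    simp only [Function.comp_def, hexpand]
    exact hinner.add (integrable_const _)
  rw [klDiv_of_ac_of_integrable hac (hint.congr hllr.symm), integral_congr_ae hllr,
    integral_map (by fun_prop) hmeas.aestronglyMeasurable]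
  simp_rw [hexpand]
  rw [integral_add hinner (integrable_const _), hzero]
  simp

theorem klDiv_map_of_measurableEmbedding {Ω Ω' : Type*} [MeasurableSpace Ω] [MeasurableSpace Ω']
    {T : Ω → Ω'} (hT : MeasurableEmbedding T) {μ ν : Measure Ω} [IsFiniteMeasure μ]
    [IsFiniteMeasure ν] (hμν : μ ≪ ν) : klDiv (μ.map T) (ν.map T) = klDiv μ ν := by
  rw [klDiv_eq_lintegral_klFun_of_ac (hT.absolutelyContinuous_map hμν),
    klDiv_eq_lintegral_klFun_of_ac hμν, hT.lintegral_map]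
  refine lintegral_congr_ae ?_
  filter_upwards [hT.rnDeriv_map μ ν] with x hx
  rw [hx]

/-- The divergences between two Gaussian measures with the same isotropic covariance are those
between a translate of the standard Gaussian measure and the latter. -/
theorem renyiDiv_map_affine_stdGaussian (m m' : EuclideanSpace ℝ (Fin d)) {s : ℝ} (hs : s ≠ 0)
    {q : ℝ} (hq : 1 ≤ q) :
    renyiDiv q ((stdGaussian (EuclideanSpace ℝ (Fin d))).map fun y => m + s • y)
      ((stdGaussian (EuclideanSpace ℝ (Fin d))).map fun y => m' + s • y)
      = ((q * (‖m - m'‖ ^ 2 / (2 * s ^ 2)) : ℝ) : EReal) := by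
  have hT := measurableEmbedding_affine m' hs
  set a := s⁻¹ • (m - m') with ha
  have hmap : (stdGaussian (EuclideanSpace ℝ (Fin d))).map (fun y => m + s • y)
      = ((stdGaussian (EuclideanSpace ℝ (Fin d))).map fun y => a + y).map
          fun y => m' + s • y := by
    rw [Measure.map_map hT.measurable (by fun_prop)]
    congr 1
    ext1 y
    simp only [Function.comp_apply, smul_add, ha, smul_inv_smul₀ hs]
    abel
  have hnorm : ‖a‖ ^ 2 / 2 = ‖m - m'‖ ^ 2 / (2 * s ^ 2) := by
    rw [ha, norm_smul, mul_pow, norm_inv, inv_pow, Real.norm_eq_abs, sq_abs]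
    field_simp
  have hac : (stdGaussian (EuclideanSpace ℝ (Fin d))).map (fun y => a + y)
      ≪ stdGaussian (EuclideanSpace ℝ (Fin d)) := by
    rw [map_add_stdGaussian]
    exact withDensity_absolutelyContinuous _ _
  have hprob : IsProbabilityMeasure
      ((stdGaussian (EuclideanSpace ℝ (Fin d))).map fun y => a + y) :=
    Measure.isProbabilityMeasure_map (by fun_prop)
  rw [hmap, ← hnorm]
  rcases hq.eq_or_lt with rfl | hq
  · rw [renyiDiv_one, klDiv_map_of_measurableEmbedding hT hac, klDiv_map_add_stdGaussian,
      EReal.coe_ennreal_ofReal, max_eq_left (by positivity), one_mul]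
  · rw [renyiDiv_of_one_lt hq (hT.absolutelyContinuous_map hac), hT.lintegral_map]
    have h := Measure.rnDeriv_withDensity (stdGaussian (EuclideanSpace ℝ (Fin d)))
      (measurable_gaussianTilt a).ennreal_ofReal
    rw [← map_add_stdGaussian] at h
    have h2 := (hT.rnDeriv_map _ _).trans h
    rw [lintegral_congr_ae (g := fun y => ENNReal.ofReal (gaussianTilt a y) ^ q)
      (h2.mono fun y hy => by simp only [hy]), lintegral_gaussianTilt_rpow,
      ENNReal.log_ofReal_of_pos (Real.exp_pos _), Real.log_exp, ← EReal.coe_mul]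
    have : q - 1 ≠ 0 := by linarith
    congr 1
    field_simp

theorem lipschitzWith_ouDrift (d : ℕ) (L : ℝ≥0) : LipschitzWith L (ouDrift d L) := by
  refine LipschitzWith.of_dist_le_mul fun x y => ?_
  rw [ouDrift, ouDrift, dist_neg_neg, dist_smul₀]
  simp

theorem ouDiffusion_mul_transpose (d : ℕ) {lam : ℝ} (hlam : 0 ≤ lam) :
    ouDiffusion d lam * (ouDiffusion d lam)ᵀ = lam • (1 : Matrix (Fin d) (Fin d) ℝ) := by
  simp [ouDiffusion, smul_smul, Real.mul_self_sqrt hlam]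

/-- The Euler kernel of the Ornstein-Uhlenbeck process. -/
def ouKernel (d : ℕ) (L lam h : ℝ) :
    Kernel (EuclideanSpace ℝ (Fin d)) (EuclideanSpace ℝ (Fin d)) :=
  eulerKernel (ouDrift d L) (measurable_ouDrift d L) (ouDiffusion d lam) h

instance isMarkovKernel_ouKernel (L lam h : ℝ) : IsMarkovKernel (ouKernel d L lam h) :=
  isMarkovKernel_eulerKernel _

open Complex in
theorem charFun_ouKernel {L lam h : ℝ} (hlam : 0 ≤ lam) (hh : 0 ≤ h)
    (x t : EuclideanSpace ℝ (Fin d)) :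
    charFun (ouKernel d L lam h x) t
      = cexp (((1 - L * h) * inner ℝ x t : ℝ) * I - (lam * h * ‖t‖ ^ 2 / 2 : ℝ)) := by
  change charFun (multivariateGaussian (x + h • ouDrift d L x)
    (h • (ouDiffusion d lam * (ouDiffusion d lam)ᵀ))) t = _
  rw [ouDiffusion_mul_transpose d hlam, smul_smul, charFun_multivariateGaussian
    (Matrix.PosSemidef.one.smul (mul_nonneg hh hlam))]
  have h1 : inner ℝ t (x + h • ouDrift d L x) = (1 - L * h) * inner ℝ x t := by
    simp only [ouDrift, inner_add_right, inner_smul_right, inner_neg_right, real_inner_comm t x]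
    ring
  have h2 : t.ofLp ⬝ᵥ ((h * lam) • (1 : Matrix (Fin d) (Fin d) ℝ)) *ᵥ t.ofLp
      = lam * h * ‖t‖ ^ 2 := by
    rw [Matrix.smul_mulVec, Matrix.one_mulVec, dotProduct_smul, EuclideanSpace.real_norm_sq_eq,
      smul_eq_mul, mul_comm h]
    simp [dotProduct, sq]
  rw [h1, h2]
  push_cast
  rfl

open Complex in
/-- Conditioning on the first step rescales the frequency `t` to `(1 - L h) ^ n • t` and adds one
term to the geometric sum of the variances. -/
theorem charFun_ouKernel_pow {L lam h : ℝ} (hlam : 0 ≤ lam) (hh : 0 ≤ h) (n : ℕ)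
    (x t : EuclideanSpace ℝ (Fin d)) :
    charFun ((ouKernel d L lam h ^ n) x) t
      = cexp (((1 - L * h) ^ n * inner ℝ x t : ℝ) * I
          - (lam * h * (∑ i ∈ Finset.range n, ((1 - L * h) ^ 2) ^ i) * ‖t‖ ^ 2 / 2 : ℝ)) := by
  induction n generalizing x with
  | zero =>
    have hid : (ouKernel d L lam h ^ 0) x = Measure.dirac x := Kernel.id_apply x
    rw [hid]
    simp
  | succ n ih =>
    have hint : Integrable (fun y : EuclideanSpace ℝ (Fin d) => cexp ((inner ℝ y t : ℝ) * I))
        (((ouKernel d L lam h ^ n) ∘ₖ ouKernel d L lam h) x) := by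
      refine Integrable.of_bound (Measurable.aestronglyMeasurable (by fun_prop)) 1
        (ae_of_all _ fun y => ?_)
      rw [Complex.norm_exp_ofReal_mul_I]
    have h1 : charFun ((ouKernel d L lam h ^ (n + 1)) x) t
        = ∫ z, charFun ((ouKernel d L lam h ^ n) z) t ∂(ouKernel d L lam h x) := by
      rw [Kernel.pow_add, pow_one, charFun_apply, Kernel.integral_comp hint]
      simp_rw [charFun_apply]
    have h2 : ∀ z, charFun ((ouKernel d L lam h ^ n) z) t
        = cexp ((inner ℝ z ((1 - L * h) ^ n • t) : ℝ) * I)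
          * cexp (-(lam * h * (∑ i ∈ Finset.range n, ((1 - L * h) ^ 2) ^ i)
            * ‖t‖ ^ 2 / 2 : ℝ)) := by
      intro z
      rw [ih, ← Complex.exp_add, inner_smul_right, sub_eq_add_neg]
    rw [h1]
    simp_rw [h2]
    rw [integral_mul_const, ← charFun_apply, charFun_ouKernel hlam hh, ← Complex.exp_add,
      Finset.sum_range_succ, norm_smul, mul_pow, Real.norm_eq_abs, sq_abs, inner_smul_right,
      pow_right_comm _ 2 n]
    push_cast
    ring_nf

/-- The law of the Euler scheme of the Ornstein-Uhlenbeck process is the Gaussian measure with mean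
`r ^ N x` and covariance `λ h (∑ i < N, r ^ (2 * i)) I`, where `r = 1 - L h`. -/
theorem ouLaw_eq {L lam h : ℝ} (hlam : 0 ≤ lam) (hh : 0 ≤ h) (N : ℕ)
    (x : EuclideanSpace ℝ (Fin d)) :
    ouLaw d L lam h N x = (stdGaussian (EuclideanSpace ℝ (Fin d))).map fun y =>
      (1 - L * h) ^ N • x
        + √(lam * h * ∑ i ∈ Finset.range N, ((1 - L * h) ^ 2) ^ i) • y := by
  have hS : 0 ≤ ∑ i ∈ Finset.range N, ((1 - L * h) ^ 2) ^ i :=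
    Finset.sum_nonneg fun _ _ => by positivity
  have h1 : ouLaw d L lam h N x = (ouKernel d L lam h ^ N) x :=
    Measure.dirac_bind (Kernel.measurable _) x
  have hprob : IsProbabilityMeasure ((stdGaussian (EuclideanSpace ℝ (Fin d))).map fun y =>
      (1 - L * h) ^ N • x
        + √(lam * h * ∑ i ∈ Finset.range N, ((1 - L * h) ^ 2) ^ i) • y) :=
    Measure.isProbabilityMeasure_map (by fun_prop)
  rw [h1]
  apply Measure.ext_of_charFun
  ext t
  rw [charFun_ouKernel_pow hlam hh]
  have h2 : ∀ (m : EuclideanSpace ℝ (Fin d)) (s : ℝ),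
      (stdGaussian (EuclideanSpace ℝ (Fin d))).map (fun y => m + s • y)
        = ((stdGaussian (EuclideanSpace ℝ (Fin d))).map fun y => s • y).map fun y => m + y := by
    intro m s
    rw [Measure.map_map (by fun_prop) (by fun_prop)]
    rfl
  rw [h2, charFun_map_const_add, charFun_map_smul, charFun_stdGaussian, ← Complex.exp_add,
    norm_smul, inner_smul_left, ← Complex.ofReal_pow, mul_pow, Real.norm_eq_abs, sq_abs,
    Real.sq_sqrt (by positivity)]
  congr 1
  simp
  ring

theorem renyiDiv_ouLaw_conv_dirac {L lam h : ℝ} (hlam : 0 < lam) (hh : 0 < h)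
    (hL : 0 ≤ L * h) (hLh : L * h < 1) {N : ℕ} (hN : 1 ≤ N) (x v v' : EuclideanSpace ℝ (Fin d))
    {q : ℝ} (hq : 1 ≤ q) :
    renyiDiv q (ouLaw d L lam h N x ∗ Measure.dirac v) (ouLaw d L lam h N x ∗ Measure.dirac v')
      = ((q * regConst lam h (1 - L * h) N * ‖v - v'‖ ^ 2 : ℝ) : EReal) := by
  have hr : 0 < 1 - L * h := by linarith
  have hS := geom_sq_pos hr hN
  have hs : √(lam * h * ∑ i ∈ Finset.range N, ((1 - L * h) ^ 2) ^ i) ≠ 0 := by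
    have : 0 < lam * h * ∑ i ∈ Finset.range N, ((1 - L * h) ^ 2) ^ i := by positivity
    exact (Real.sqrt_pos.2 this).ne'
  have h1 : ∀ w : EuclideanSpace ℝ (Fin d), ouLaw d L lam h N x ∗ Measure.dirac w
      = (stdGaussian (EuclideanSpace ℝ (Fin d))).map fun y => ((1 - L * h) ^ N • x + w)
        + √(lam * h * ∑ i ∈ Finset.range N, ((1 - L * h) ^ 2) ^ i) • y := by
    intro w
    rw [ouLaw_eq hlam.le hh.le]
    have : IsProbabilityMeasure ((stdGaussian (EuclideanSpace ℝ (Fin d))).map fun y =>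
        (1 - L * h) ^ N • x
          + √(lam * h * ∑ i ∈ Finset.range N, ((1 - L * h) ^ 2) ^ i) • y) :=
      Measure.isProbabilityMeasure_map (by fun_prop)
    rw [Measure.conv_dirac, Measure.map_map (by fun_prop) (by fun_prop)]
    congr 1
    ext1 y
    simp only [Function.comp_apply]
    abel
  rw [h1, h1, renyiDiv_map_affine_stdGaussian _ _ hs hq, Real.sq_sqrt (by positivity),
    add_sub_add_left_eq_sub, regConst_eq hr (by linarith) hN]
  congr 1
  ring

end OrnsteinUhlenbeck

/-! ### The regularity bounds and their tightness -/

theorem shiftHarnack_eulerLaw {d m : ℕ} {L : ℝ≥0} {lam h : ℝ} (hlam : 0 < lam) (hh : 0 < h)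
    (hLh : (L : ℝ) * h < 1) {N : ℕ} (hN : 1 ≤ N)
    {b : EuclideanSpace ℝ (Fin d) → EuclideanSpace ℝ (Fin d)} (hb : LipschitzWith L b)
    {σ : Matrix (Fin d) (Fin m) ℝ}
    (hσ : (σ * σᵀ - lam • (1 : Matrix (Fin d) (Fin d) ℝ)).PosSemidef)
    (μ : Measure (EuclideanSpace ℝ (Fin d))) [IsProbabilityMeasure μ] :
    ShiftHarnack (eulerLaw b hb.continuous.measurable σ h N μ)
      (regConst lam h (1 - L * h) N) :=
  shiftHarnack_bind (fun x _ _ hpq v v' _ hf =>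
    lintegral_eulerKernel_pow_add_le hlam hh hLh hN hb hσ hpq x v v' hf) μ

end

theorem mainTheorem3 (d : ℕ) (L : ℝ≥0) (lam h : ℝ) (hlam : 0 < lam) (hh : 0 < h)
    (hLh : (L : ℝ) * h < 1) (N : ℕ) (hN : 1 ≤ N) :
    -- the regularity bounds
    (∀ (m : ℕ) (b : EuclideanSpace ℝ (Fin d) → EuclideanSpace ℝ (Fin d))
        (hb : LipschitzWith L b) (σ : Matrix (Fin d) (Fin m) ℝ)
        (_ : (σ * σᵀ - lam • (1 : Matrix (Fin d) (Fin d) ℝ)).PosSemidef)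
        (μ ν ν' : Measure (EuclideanSpace ℝ (Fin d)))
        (_ : IsProbabilityMeasure μ) (_ : IsProbabilityMeasure ν) (_ : IsProbabilityMeasure ν'),
      klDiv (eulerLaw b hb.continuous.measurable σ h N μ ∗ ν)
          (eulerLaw b hb.continuous.measurable σ h N μ ∗ ν')
        ≤ ENNReal.ofReal (regConst lam h (1 - L * h) N) * wasserstein2 ν ν' ^ 2 ∧
      ∀ q : ℝ, 1 ≤ q →
        renyiDiv q (eulerLaw b hb.continuous.measurable σ h N μ ∗ ν)
            (eulerLaw b hb.continuous.measurable σ h N μ ∗ ν')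
          ≤ ⨅ γ ∈ couplings ν ν', renyiCost q (regConst lam h (1 - L * h) N) γ) ∧
    -- the Ornstein–Uhlenbeck process satisfies the hypotheses and attains equality
    (LipschitzWith L (ouDrift d L) ∧
      (ouDiffusion d lam * (ouDiffusion d lam)ᵀ
        - lam • (1 : Matrix (Fin d) (Fin d) ℝ)).PosSemidef ∧
      ∀ x v v' : EuclideanSpace ℝ (Fin d),
        klDiv (ouLaw d L lam h N x ∗ Measure.dirac v) (ouLaw d L lam h N x ∗ Measure.dirac v')
            = ENNReal.ofReal (regConst lam h (1 - L * h) N * ‖v - v'‖ ^ 2) ∧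
        klDiv (ouLaw d L lam h N x ∗ Measure.dirac v) (ouLaw d L lam h N x ∗ Measure.dirac v')
            = ENNReal.ofReal (regConst lam h (1 - L * h) N)
                * wasserstein2 (Measure.dirac v) (Measure.dirac v') ^ 2 ∧
        ∀ q : ℝ, 1 ≤ q →
          renyiDiv q (ouLaw d L lam h N x ∗ Measure.dirac v)
              (ouLaw d L lam h N x ∗ Measure.dirac v')
            = ((q * regConst lam h (1 - L * h) N * ‖v - v'‖ ^ 2 : ℝ) : EReal) ∧
          renyiDiv q (ouLaw d L lam h N x ∗ Measure.dirac v)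
              (ouLaw d L lam h N x ∗ Measure.dirac v')
            = ⨅ γ ∈ couplings (Measure.dirac v) (Measure.dirac v'),
                renyiCost q (regConst lam h (1 - L * h) N) γ) := by
  have hL0 : 0 ≤ (L : ℝ) * h := mul_nonneg L.2 hh.le
  have hc := regConst_pos hlam hh (sub_pos.2 hLh) (sub_le_self 1 hL0) hN
  have hσ : (ouDiffusion d lam * (ouDiffusion d lam)ᵀ
      - lam • (1 : Matrix (Fin d) (Fin d) ℝ)).PosSemidef := by
    rw [ouDiffusion_mul_transpose d hlam.le, sub_self]
    exact Matrix.PosSemidef.zero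
  refine ⟨fun m b hb σ hσ μ ν ν' _ _ _ => ?_, lipschitzWith_ouDrift d L, hσ, fun x v v' => ?_⟩
  · have hρ := shiftHarnack_eulerLaw hlam hh hLh hN hb hσ μ
    exact ⟨klDiv_conv_le_wasserstein2 hc hρ,
      fun q hq => le_iInf₂ fun γ hγ => renyiDiv_conv_le hc.le hρ hγ hq⟩
  · have hR := fun (q : ℝ) (hq : 1 ≤ q) =>
      renyiDiv_ouLaw_conv_dirac hlam hh hL0 hLh hN x v v' hq
    have hkl : klDiv (ouLaw d L lam h N x ∗ Measure.dirac v)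
        (ouLaw d L lam h N x ∗ Measure.dirac v')
          = ENNReal.ofReal (regConst lam h (1 - L * h) N * ‖v - v'‖ ^ 2) := by
      have h1 := hR 1 le_rfl
      rw [renyiDiv_one, one_mul] at h1
      rw [← EReal.coe_ennreal_eq_coe_ennreal_iff, h1, EReal.coe_ennreal_ofReal,
        max_eq_left (by positivity)]
    refine ⟨hkl, ?_, fun q hq => ⟨hR q hq, ?_⟩⟩
    · rw [hkl, wasserstein2_dirac_sq, ENNReal.ofReal_mul hc.le]
    · rw [hR q hq, couplings_dirac, iInf_singleton, renyiCost_dirac hc.le hq]
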